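/- **Lemma 3.2 (Subconic Ends).** Let $d\ge 1$, let $N$ be a closed (compact, without boundary) smooth $(d-1)$-dimensional manifold with a smooth Riemannian metric $h$, and let $\theta\in C^\infty([1,\infty);\mathbb R_{>0})$ satisfy $\lim_{r\to\infty}\theta(r)=\infty$ and $\sup_{r\ge1}|\theta^{(m)}(r)|<\infty$ for every $m\ge 1$. The subconic end is $N\times(1,\infty)_r$ with the metric $g_0=dr^2+\theta(r)^2h$. Let $(M,g)$ be a smooth $d$-dimensional Riemannian manifold without boundary which contains the end $N\times(1,\infty)$ as an open subset (through a diffeomorphism onto that subset), such that $c\,g_0\le g\le C\,g_0$ on the end for some constants $c, C>0$ (for instance $g=g_0$ there). Let $a:M\to\mathbb R$, and assume the Network Control Condition: there are $L,\omega,\beta>0$ and a set of points $\{x_m\}\subset M$ such that every $x\in M$ satisfies $d_g(x,\bigcup_m\{x_m\})\le L$, and $\bigcup_m B_g(x_m,\omega)\subset\Omega_{2\beta}$, where $\Omega_{2\beta}=\{x\in M: a(x)>2\beta\}$. Then there exist $R\ge 1$, a finite $n\ge1$, functions $\psi_1,\dots,\psi_n\in C_b^\infty(M_R,\mathbb R)$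 on $M_R=N\times(R,\infty)$, and a constant $\rho>0$, such that $0\le\psi_k\le3$ on $M_R$ for every $k$, and such that for every $k$ and every $x\in M_R\setminus\Omega_{2\beta}$ with $|\nabla_{g_0}\psi_k(x)|<2\rho$ there is an $l$ (depending on $x$) with $$\psi_l(x)\ge1,\qquad |\nabla_{g_0}\psi_l(x)|\ge2\rho,\qquad \psi_l(x)\ge\psi_k(x)+\tfrac12 .$$ Here $\psi\in C_b^\infty(M_R,\mathbb R)$ means that $\psi$ is smooth on $M_R$ and, for each $j\ge0$, $\sup_{M_R}|\nabla^j\psi|_{g_0}<\infty$, where $\nabla^j\psi$ is the $j$-th iterated covariant derivative for the Levi-Civita connection of $g_0$. -/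

import Mathlib

open Set Filter Topology Manifold Bundle
open scoped ContDiff ENNReal

noncomputable section

/-! ### Covariant derivatives of functions on a Riemannian manifold

A (pseudo-)metric tensor is given as a field `G` of bilinear forms on the tangent spaces.  All
coordinate expressions refer to a chart `e` of the manifold and to a basis `b` of the model vector
space, so that `z ↦ (e.extend I).symm z` is the local parametrization and
`(∂_i)_z = d(e.extend I).symm_z (b i)` are the coordinate vector fields. -/

section Covariant

variable {E : Type*} [NormedAddCommGroup E] [NormedSpace ℝ E]
  {H : Type*} [TopologicalSpace H] {I : ModelWithCorners ℝ E H}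
  {M : Type*} [TopologicalSpace M] [ChartedSpace H M]
  {ι : Type*} [Fintype ι] [DecidableEq ι]

/-- The components `g_{ij}` of the metric `G` in the chart `e`. -/
def coordMetric (G : ∀ p : M, TangentSpace I p → TangentSpace I p → ℝ) (b : Module.Basis ι ℝ E)
    (e : OpenPartialHomeomorph M H) (z : E) : Matrix ι ι ℝ :=
  Matrix.of fun i j =>
    G ((e.extend I).symm z)
      (mfderiv 𝓘(ℝ, E) I (e.extend I).symm z (b i))
      (mfderiv 𝓘(ℝ, E) I (e.extend I).symm z (b j))

/-- The partial derivative `∂_i u` of a function `u` of the coordinates. -/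
def coordDeriv (b : Module.Basis ι ℝ E) (i : ι) (u : E → ℝ) (z : E) : ℝ :=
  fderiv ℝ u z (b i)

/-- The Christoffel symbols of the Levi-Civita connection of `G` in the chart `e`:
`Γ^k_{ij} = 1/2 ∑_l g^{kl} (∂_i g_{jl} + ∂_j g_{il} - ∂_l g_{ij})`. -/
def christoffel (G : ∀ p : M, TangentSpace I p → TangentSpace I p → ℝ) (b : Module.Basis ι ℝ E)
    (e : OpenPartialHomeomorph M H) (k i j : ι) (z : E) : ℝ :=
  (1 / 2 : ℝ) * ∑ l, (coordMetric G b e z)⁻¹ k l *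
    (coordDeriv b i (fun w => coordMetric G b e w j l) z
      + coordDeriv b j (fun w => coordMetric G b e w i l) z
      - coordDeriv b l (fun w => coordMetric G b e w i j) z)

/-- The components, in the chart `e`, of the `j`-th iterated covariant derivative `∇^j f` of a
function `f` with respect to the Levi-Civita connection of `G`:
`(∇^{j+1} f)_{α_0 α_1 … α_j} = ∂_{α_0} (∇^j f)_{α_1 … α_j}
  - ∑_s ∑_k Γ^k_{α_0 α_s} (∇^j f)_{α_1 … k … α_j}`, the index `k` being in position `s`. -/
def covDeriv (G : ∀ p : M, TangentSpace I p → TangentSpace I p → ℝ) (b : Module.Basis ι ℝ E)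
    (e : OpenPartialHomeomorph M H) (f : M → ℝ) : (j : ℕ) → (Fin j → ι) → E → ℝ
  | 0, _ => fun z => f ((e.extend I).symm z)
  | j + 1, α => fun z =>
      coordDeriv b (α 0) (covDeriv G b e f j (Fin.tail α)) z
        - ∑ s : Fin j, ∑ k : ι, christoffel G b e k (α 0) (Fin.tail α s) z *
            covDeriv G b e f j (Function.update (Fin.tail α) s k) z

/-- The pointwise norm `|∇^j f|_G` at `p`, computed in a chart `e` around `p`:
`|∇^j f|² = ∑_{α, β} g^{α_1 β_1} ⋯ g^{α_j β_j} (∇^j f)_α (∇^j f)_β`. -/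
def covNorm (G : ∀ p : M, TangentSpace I p → TangentSpace I p → ℝ) (b : Module.Basis ι ℝ E)
    (e : OpenPartialHomeomorph M H) (f : M → ℝ) (j : ℕ) (p : M) : ℝ :=
  Real.sqrt (∑ α : Fin j → ι, ∑ β : Fin j → ι,
    (∏ s, (coordMetric G b e (e.extend I p))⁻¹ (α s) (β s)) *
      covDeriv G b e f j α (e.extend I p) * covDeriv G b e f j β (e.extend I p))

/-- `f` belongs to `C_b^∞(U)` for the metric `G` on the open set `U`: it is smooth on `U`, and for
each `j` the function `|∇^j f|_G` is bounded on `U`.  For smooth `f` the number `|∇^j f|_G (p)` is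
the norm of a tensor: it depends neither on the smooth chart around `p` in which it is computed nor
on the basis `b`, so that "in some chart" and "in every chart" mean the same here. -/
def IsCbInfty (G : ∀ p : M, TangentSpace I p → TangentSpace I p → ℝ) (b : Module.Basis ι ℝ E)
    (U : Set M) (f : M → ℝ) : Prop :=
  ContMDiffOn I 𝓘(ℝ, ℝ) ∞ f U ∧
    ∀ j : ℕ, ∃ C : ℝ, ∀ p ∈ U, ∃ e ∈ IsManifold.maximalAtlas I ∞ M,
      p ∈ e.source ∧ covNorm G b e f j p ≤ C

/-- The length `|∇_G f (p)|` of the gradient of `f`, that is, the norm of the linear form `df_p`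
dual to the norm `√(G_p (v, v))` on the tangent space. -/
def gradNorm (G : ∀ p : M, TangentSpace I p → TangentSpace I p → ℝ) (f : M → ℝ) (p : M) : ℝ :=
  sSup {s : ℝ | ∃ v : TangentSpace I p, G p v v ≤ 1 ∧
    s = (show ℝ from mfderiv I 𝓘(ℝ, ℝ) f p v)}

end Covariant

/-! ### Subconic ends -/

/-- The scaling functions of subconic ends: smooth positive functions on `[1, ∞)` that tend to
infinity and all of whose derivatives of order at least one are bounded. -/
structure IsSubconicScaling (θ : ℝ → ℝ) : Prop where
  smooth : ContDiffOn ℝ ∞ θ (Ici 1)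
  pos : ∀ r, 1 ≤ r → 0 < θ r
  tendsto : Tendsto θ atTop atTop
  bounded : ∀ m : ℕ, 1 ≤ m → ∃ C : ℝ, ∀ r, 1 ≤ r → |iteratedDerivWithin m θ (Ici 1) r| ≤ C

/-- The model with corners of the product `N × ℝ`, where `N` is an `n`-dimensional manifold. -/
abbrev endModel (n : ℕ) : ModelWithCorners ℝ (EuclideanSpace ℝ (Fin n) × ℝ)
    (ModelProd (EuclideanSpace ℝ (Fin n)) ℝ) :=
  (𝓡 n).prod 𝓘(ℝ, ℝ)

/-- The standard basis of `ℝⁿ × ℝ`. -/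
def endBasis (n : ℕ) : Module.Basis (Fin n ⊕ Unit) ℝ (EuclideanSpace ℝ (Fin n) × ℝ) :=
  (EuclideanSpace.basisFun (Fin n) ℝ).toBasis.prod (Module.Basis.singleton Unit ℝ)

/-- The metric `dr² + θ(r)² h` on `N × ℝ`, at the point `p = (y, r)`; here `h` is the Riemannian
metric of `N`. -/
def warpedMetric (n : ℕ) {N : Type*} [TopologicalSpace N]
    [ChartedSpace (EuclideanSpace ℝ (Fin n)) N] [IsManifold (𝓡 n) ∞ N]
    [RiemannianBundle (fun y : N => TangentSpace (𝓡 n) y)] (θ : ℝ → ℝ)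
    (p : N × ℝ) (v w : TangentSpace (endModel n) p) : ℝ :=
  (show ℝ from mfderiv (endModel n) 𝓘(ℝ, ℝ) Prod.snd p v)
      * (show ℝ from mfderiv (endModel n) 𝓘(ℝ, ℝ) Prod.snd p w)
    + θ p.2 ^ 2 * inner ℝ (mfderiv (endModel n) (𝓡 n) Prod.fst p v)
        (mfderiv (endModel n) (𝓡 n) Prod.fst p w)

/-! ### The control condition -/

/-- The control region `Ω_υ = {a > υ}`. -/
def controlRegion {M : Type*} (a : M → ℝ) (υ : ℝ) : Set M := {x | υ < a x}

/-- The Network Control Condition `(L, η, 2β, P)` for the damping `a`: each point is within distance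
`L` of the set `P`, and the balls of radius `η` about the points of `P` lie in `{a > 2β}`. -/
structure NetworkControl {M : Type*} [PseudoEMetricSpace M] (a : M → ℝ) (L η β : ℝ)
    (P : Set M) : Prop where
  L_pos : 0 < L
  η_pos : 0 < η
  β_pos : 0 < β
  dist_le : ∀ x, Metric.infEDist x P ≤ ENNReal.ofReal L
  ball_subset : ∀ p ∈ P, ∀ x, edist x p < ENNReal.ofReal η → x ∈ controlRegion a (2 * β)

end

set_option linter.unusedSectionVars false

/-! Near a point of large height `r₀`, with coordinate `v₀` in a chart `φ` of `N`, use the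
coordinates `(θ(r₀)(φ(y) - v₀), r - r₀)`. In them `g₀` is `ds² + (θ(r)/θ(r₀))² h`. Since `θ'` is
bounded and `θ → ∞`, on balls of a fixed radius the ratio `θ(r)/θ(r₀)` lies in `[1/2, 2]`, and the
balls fit inside the chart (`exists_isGoodCenter`). So, uniformly in the center, `g₀` is comparable
with the Euclidean metric (`IsGoodCenter.metric_bounds`) and all derivatives of its coefficients are
bounded. A fixed smooth function transported by these coordinates therefore has covariant
derivatives bounded independently of the center (`exists_covNorm_radialBump_le`).

Around points of the network put such transported copies of one radial bump of radius `T`, with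
maximum `3` at the center and no other critical point where it is positive. The `η`-ball around the
center is controlled, so an uncontrolled point stays away from the center, and the gradient is
bounded below there as soon as the bump is at least `1` (`IsGoodCenter.le_gradNorm`).

Network points may crowd together, so only one is kept in each occupied cell of a grid of unit mesh.
The kept points are sorted, chart by chart, by the residues of their cell indices modulo a large
`q`: within one class the balls of radius `2T` are disjoint (`cellIndex_eq_of_mem_endBall`). Each of
these finitely many classes gives one function, the sum of its bumps (`isCbInfty_clusterFun`).

A point high in the end has a network point within `g`-distance `L + 1`, hence at bounded rescaled
distance (`IsGoodCenter.exists_of_edist_lt`), hence a kept center within `T / 4`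
(`sqNorm_endCoord_le_of_cellIndex_eq`). So some `ψ_l` is at least `2` there. If an uncontrolled
point has `|∇ψ_k| < 2ρ`, then `ψ_k < 1`, and this `ψ_l` has the three required properties. -/

noncomputable section

/-! ### Calculus of families with derivatives of all orders bounded uniformly at base points. -/

section UniformlySmooth

variable {E : Type*} [NormedAddCommGroup E] [NormedSpace ℝ E]
  {F : Type*} [NormedAddCommGroup F] [NormedSpace ℝ F]
  {F' : Type*} [NormedAddCommGroup F'] [NormedSpace ℝ F']
  {A : Type*} {z : A → E}

/-- A family of maps `u a`, each smooth at the point `z a`, all of whose derivatives at these points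
are bounded uniformly in `a`. -/
def UnifSmoothAt (z : A → E) (u : A → E → F) : Prop :=
  (∀ a, ContDiffAt ℝ ∞ (u a) (z a)) ∧
    ∀ k : ℕ, ∃ C : ℝ, ∀ a, ‖iteratedFDeriv ℝ k (u a) (z a)‖ ≤ C

namespace UnifSmoothAt

theorem congr {u v : A → E → F} (hu : UnifSmoothAt z u) (h : ∀ a, v a =ᶠ[𝓝 (z a)] u a) :
    UnifSmoothAt z v := by
  refine ⟨fun a => (hu.1 a).congr_of_eventuallyEq (h a), fun k => ?_⟩
  obtain ⟨C, hC⟩ := hu.2 k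
  refine ⟨C, fun a => ?_⟩
  rw [((h a).iteratedFDeriv ℝ k).eq_of_nhds]
  exact hC a

theorem clm_comp {u : A → E → F} (hu : UnifSmoothAt z u) (l : F →L[ℝ] F') :
    UnifSmoothAt z fun a w => l (u a w) := by
  refine ⟨fun a => l.contDiff.contDiffAt.comp _ (hu.1 a), fun k => ?_⟩
  obtain ⟨C, hC⟩ := hu.2 k
  refine ⟨‖l‖ * C, fun a => ?_⟩
  have := l.norm_iteratedFDeriv_comp_left (hu.1 a) (n := k) (by exact_mod_cast le_top)
  exact this.trans (mul_le_mul_of_nonneg_left (hC a) (norm_nonneg _))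

theorem add {u v : A → E → F} (hu : UnifSmoothAt z u) (hv : UnifSmoothAt z v) :
    UnifSmoothAt z fun a w => u a w + v a w := by
  refine ⟨fun a => (hu.1 a).add (hv.1 a), fun k => ?_⟩
  obtain ⟨C, hC⟩ := hu.2 k
  obtain ⟨D, hD⟩ := hv.2 k
  refine ⟨C + D, fun a => ?_⟩
  have := iteratedFDeriv_add_apply (i := k) ((hu.1 a).of_le (by exact_mod_cast le_top))
    ((hv.1 a).of_le (by exact_mod_cast le_top))
  change iteratedFDeriv ℝ k (fun w => u a w + v a w) (z a) = _ at this
  rw [this]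
  exact (norm_add_le _ _).trans (add_le_add (hC a) (hD a))

theorem prodMk {u : A → E → F} {v : A → E → F'} (hu : UnifSmoothAt z u) (hv : UnifSmoothAt z v) :
    UnifSmoothAt z fun a w => (u a w, v a w) := by
  have h := (hu.clm_comp (ContinuousLinearMap.inl ℝ F F')).add
    (hv.clm_comp (ContinuousLinearMap.inr ℝ F F'))
  simpa using h

theorem const (c : F) : UnifSmoothAt z fun _ _ => c := by
  refine ⟨fun a => contDiffAt_const, fun k => ⟨‖c‖, fun a => ?_⟩⟩
  rcases k with _ | k
  · simp
  · rw [iteratedFDeriv_succ_const]; simp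

theorem bounded {u : A → E → F} (hu : UnifSmoothAt z u) : ∃ C, ∀ a, ‖u a (z a)‖ ≤ C := by
  obtain ⟨C, hC⟩ := hu.2 0
  exact ⟨C, fun a => by simpa using hC a⟩

theorem exists_isOpen_contDiffOn {f : E → F} {x : E} (hf : ContDiffAt ℝ ∞ f x) (k : ℕ) :
    ∃ s, IsOpen s ∧ x ∈ s ∧ ContDiffOn ℝ k f s := by
  obtain ⟨s, hs, h'⟩ := (hf.of_le (m := k) (by exact_mod_cast le_top)).contDiffOn le_rfl (by simp)
  refine ⟨interior s, isOpen_interior, mem_interior_iff_mem_nhds.2 (by simpa using hs), ?_⟩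
  exact h'.mono interior_subset

/-- Uniform smoothness is preserved by composition. -/
theorem comp {u : A → E → F} {g : A → F → F'} (hg : UnifSmoothAt (fun a => u a (z a)) g)
    (hu : UnifSmoothAt z u) : UnifSmoothAt z fun a w => g a (u a w) := by
  refine ⟨fun a => (hg.1 a).comp _ (hu.1 a), fun k => ?_⟩
  choose C hC using hg.2
  choose D hD using hu.2
  set C' : ℝ := ∑ i ∈ Finset.range (k + 1), |C i|
  -- The summand `1` makes `D' ≥ 1`, so that `D' ≤ D' ^ i`: the Faà di Bruno estimate used below
  -- wants the `i`-th derivative of the inner map bounded by `D' ^ i`.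
  set D' : ℝ := 1 + ∑ i ∈ Finset.range (k + 1), |D i|
  refine ⟨k.factorial * C' * D' ^ k, fun a => ?_⟩
  obtain ⟨s, hs, hxs, hus⟩ := exists_isOpen_contDiffOn (hu.1 a) k
  obtain ⟨U, hU, hxU, hgU⟩ := exists_isOpen_contDiffOn (hg.1 a) k
  set s' := s ∩ u a ⁻¹' U
  have hs' : IsOpen s' := hus.continuousOn.isOpen_inter_preimage hs hU
  have hxs' : z a ∈ s' := ⟨hxs, hxU⟩
  have e1 := iteratedFDerivWithin_of_isOpen (𝕜 := ℝ) (f := g a ∘ u a) k hs' hxs'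
  change ‖iteratedFDeriv ℝ k (g a ∘ u a) (z a)‖ ≤ _
  rw [← e1]
  refine norm_iteratedFDerivWithin_comp_le (N := k) hgU
    (hus.mono inter_subset_left) le_rfl hU.uniqueDiffOn hs'.uniqueDiffOn
    (fun x hx => hx.2) hxs' (fun i hi => ?_) (fun i hi hi' => ?_)
  · rw [iteratedFDerivWithin_of_isOpen i hU hxU]
    refine (hC i a).trans ((le_abs_self _).trans ?_)
    exact Finset.single_le_sum (f := fun i => |C i|) (fun _ _ => abs_nonneg _)
      (Finset.mem_range.2 (by omega))
  · rw [iteratedFDerivWithin_of_isOpen i hs' hxs']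
    have h1 : |D i| ≤ ∑ i ∈ Finset.range (k + 1), |D i| :=
      Finset.single_le_sum (f := fun i => |D i|) (fun _ _ => abs_nonneg _)
        (Finset.mem_range.2 (by omega))
    have h2 : (1 : ℝ) ≤ D' := by
      have : 0 ≤ ∑ i ∈ Finset.range (k + 1), |D i| := Finset.sum_nonneg fun _ _ => abs_nonneg _
      simp only [D']; linarith
    calc _ ≤ |D i| := (hD i a).trans (le_abs_self _)
      _ ≤ D' := by simp only [D']; linarith
      _ ≤ D' ^ i := le_self_pow₀ h2 (by omega)

/-- A fixed smooth map is uniformly smooth along base points in a compact subset of its domain. -/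
theorem of_isCompact {g : E → F} {U K : Set E} (hU : IsOpen U) (hg : ContDiffOn ℝ ∞ g U)
    (hK : IsCompact K) (hKU : K ⊆ U) (h : ∀ a, z a ∈ K) : UnifSmoothAt z fun _ => g := by
  have hgat : ∀ x ∈ U, ContDiffAt ℝ ∞ g x := fun x hx => hg.contDiffAt (hU.mem_nhds hx)
  refine ⟨fun a => hgat _ (hKU (h a)), fun k => ?_⟩
  obtain ⟨C, hC⟩ : ∃ C, ∀ x ∈ K, ‖iteratedFDeriv ℝ k g x‖ ≤ C := by
    refine hK.exists_bound_of_continuousOn fun x hx => ContinuousAt.continuousWithinAt ?_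
    exact (hgat x (hKU hx)).continuousAt_iteratedFDeriv (by exact_mod_cast le_top)
  exact ⟨C, fun a => hC _ (h a)⟩

theorem clm (l : E →L[ℝ] F) (h : ∃ C, ∀ a, ‖z a‖ ≤ C) : UnifSmoothAt z fun _ w => l w := by
  refine ⟨fun a => l.contDiff.contDiffAt, fun k => ?_⟩
  obtain ⟨C, hC⟩ := h
  rcases k with _ | _ | k
  · refine ⟨‖l‖ * C, fun a => ?_⟩
    simpa using (l.le_opNorm _).trans (mul_le_mul_of_nonneg_left (hC a) (norm_nonneg _))
  · refine ⟨‖l‖, fun a => ?_⟩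
    rw [norm_iteratedFDeriv_one]
    simp
  · refine ⟨0, fun a => ?_⟩
    have h1 : fderiv ℝ (fun w => l w) = fun _ => l := by ext1 w; exact l.fderiv
    rw [← norm_iteratedFDeriv_fderiv, h1, iteratedFDeriv_succ_const]
    simp

/-- The product is a fixed polynomial composed with the pair, whose values stay in a compact ball,
so no Leibniz formula is needed. -/
theorem mul {u v : A → E → ℝ} (hu : UnifSmoothAt z u) (hv : UnifSmoothAt z v) :
    UnifSmoothAt z fun a w => u a w * v a w := by
  obtain ⟨C, hC⟩ := (hu.prodMk hv).bounded
  refine comp (g := fun _ p => p.1 * p.2) ?_ (hu.prodMk hv)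
  exact of_isCompact isOpen_univ (contDiff_fst.mul contDiff_snd).contDiffOn
    (isCompact_closedBall (0 : ℝ × ℝ) C) (subset_univ _) (fun a => by simpa using hC a)

theorem neg {u : A → E → F} (hu : UnifSmoothAt z u) : UnifSmoothAt z fun a w => -u a w :=
  hu.clm_comp (-ContinuousLinearMap.id ℝ F)

theorem sub {u v : A → E → F} (hu : UnifSmoothAt z u) (hv : UnifSmoothAt z v) :
    UnifSmoothAt z fun a w => u a w - v a w := by
  simpa only [sub_eq_add_neg] using hu.add hv.neg

theorem sum {κ : Type*} (s : Finset κ) {u : κ → A → E → F} (hu : ∀ k, UnifSmoothAt z (u k)) :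
    UnifSmoothAt z fun a w => ∑ k ∈ s, u k a w := by
  classical
  induction s using Finset.induction_on with
  | empty => simpa using const (z := z) (0 : F)
  | insert k s hk ih =>
    simp only [Finset.sum_insert hk]
    exact (hu k).add ih

theorem prod {κ : Type*} (s : Finset κ) {u : κ → A → E → ℝ} (hu : ∀ k, UnifSmoothAt z (u k)) :
    UnifSmoothAt z fun a w => ∏ k ∈ s, u k a w := by
  classical
  induction s using Finset.induction_on with
  | empty => simpa using const (z := z) (1 : ℝ)
  | insert k s hk ih =>
    simp only [Finset.prod_insert hk]
    exact (hu k).mul ih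

theorem fderiv_apply {u : A → E → F} (hu : UnifSmoothAt z u) (b : E) :
    UnifSmoothAt z fun a w => fderiv ℝ (u a) w b := by
  have h1 : ∀ a, ContDiffAt ℝ ∞ (fderiv ℝ (u a)) (z a) := fun a =>
    (hu.1 a).fderiv_right (by simp)
  refine ⟨fun a => (h1 a).clm_apply contDiffAt_const, fun k => ?_⟩
  obtain ⟨C, hC⟩ := hu.2 (k + 1)
  refine ⟨‖b‖ * C, fun a => ?_⟩
  refine (norm_iteratedFDeriv_clm_apply_const (h1 a) (by exact_mod_cast le_top)).trans ?_
  rw [norm_iteratedFDeriv_fderiv]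
  exact mul_le_mul_of_nonneg_left (hC a) (norm_nonneg _)

theorem const_smul {u : A → E → F} (hu : UnifSmoothAt z u) {c : A → ℝ}
    (hc : ∃ C, ∀ a, |c a| ≤ C) : UnifSmoothAt z fun a w => c a • u a w := by
  refine ⟨fun a => contDiffAt_const.smul (hu.1 a), fun k => ?_⟩
  obtain ⟨C, hC⟩ := hu.2 k
  obtain ⟨D, hD⟩ := hc
  refine ⟨D * C, fun a => ?_⟩
  have := iteratedFDeriv_const_smul_apply (i := k) (a := c a)
    ((hu.1 a).of_le (by exact_mod_cast le_top))
  change iteratedFDeriv ℝ k (fun w => c a • u a w) (z a) = _ at this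
  rw [this, norm_smul]
  exact mul_le_mul (hD a) (hC a) (norm_nonneg _) ((abs_nonneg _).trans (hD a))

/-- A constant affects only the derivative of order zero. The bound is asked of the sum because in
the application it is the sum that is known to lie in a compact set. -/
theorem add_const {u : A → E → F} (hu : UnifSmoothAt z u) {c : A → F}
    (hc : ∃ C, ∀ a, ‖u a (z a) + c a‖ ≤ C) : UnifSmoothAt z fun a w => u a w + c a := by
  refine hu.add (v := fun a _ => c a) ⟨fun a => contDiffAt_const, fun k => ?_⟩
  rcases k with _ | k
  · obtain ⟨C, hC⟩ := hc
    obtain ⟨D, hD⟩ := hu.bounded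
    refine ⟨C + D, fun a => ?_⟩
    rw [norm_iteratedFDeriv_zero]
    calc ‖c a‖ = ‖(u a (z a) + c a) - u a (z a)‖ := by rw [add_sub_cancel_left]
      _ ≤ _ := (norm_sub_le _ _).trans (add_le_add (hC a) (hD a))
  · exact ⟨0, fun a => by rw [iteratedFDeriv_succ_const]; simp⟩

end UnifSmoothAt

end UniformlySmooth

/-! ### Covariant derivatives of a uniformly smooth family. -/

section CovariantBounds

variable {E : Type*} [NormedAddCommGroup E] [NormedSpace ℝ E]
  {H : Type*} [TopologicalSpace H] {I : ModelWithCorners ℝ E H}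
  {M : Type*} [TopologicalSpace M] [ChartedSpace H M]
  {ι : Type*} [Fintype ι] [DecidableEq ι]
  {A : Type*} {z : A → E} {G : ∀ p : M, TangentSpace I p → TangentSpace I p → ℝ}
  {b : Module.Basis ι ℝ E} {e : A → OpenPartialHomeomorph M H} {f : A → M → ℝ}

theorem unifSmoothAt_christoffel
    (hG : ∀ i j, UnifSmoothAt z fun a w => coordMetric G b (e a) w i j)
    (hG' : ∀ i j, UnifSmoothAt z fun a w => (coordMetric G b (e a) w)⁻¹ i j) (k i j : ι) :
    UnifSmoothAt z fun a => christoffel G b (e a) k i j := by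
  unfold christoffel coordDeriv
  refine (UnifSmoothAt.const _).mul (UnifSmoothAt.sum _ fun l => (hG' k l).mul ?_)
  exact (((hG j l).fderiv_apply _).add ((hG i l).fderiv_apply _)).sub ((hG i j).fderiv_apply _)

theorem unifSmoothAt_covDeriv
    (hG : ∀ i j, UnifSmoothAt z fun a w => coordMetric G b (e a) w i j)
    (hG' : ∀ i j, UnifSmoothAt z fun a w => (coordMetric G b (e a) w)⁻¹ i j)
    (hf : UnifSmoothAt z fun a w => f a (((e a).extend I).symm w)) (j : ℕ) (α : Fin j → ι) :
    UnifSmoothAt z fun a => covDeriv G b (e a) (f a) j α := by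
  induction j with
  | zero => exact hf
  | succ j ih =>
    simp only [covDeriv, coordDeriv]
    refine ((ih _).fderiv_apply _).sub (UnifSmoothAt.sum _ fun s => UnifSmoothAt.sum _ fun k => ?_)
    exact (unifSmoothAt_christoffel hG hG' _ _ _).mul (ih _)

/-- The squared norm is a polynomial in the inverse metric and in the components of `∇^j f`, and
these are built from the metric by sums, products and partial derivatives. The chart may vary with
`a`; only the bounds have to be uniform. -/
theorem exists_covNorm_le {p : A → M} (hp : ∀ a, (e a).extend I (p a) = z a)
    (hG : ∀ i j, UnifSmoothAt z fun a w => coordMetric G b (e a) w i j)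
    (hG' : ∀ i j, UnifSmoothAt z fun a w => (coordMetric G b (e a) w)⁻¹ i j)
    (hf : UnifSmoothAt z fun a w => f a (((e a).extend I).symm w)) (j : ℕ) :
    ∃ C, ∀ a, covNorm G b (e a) (f a) j (p a) ≤ C := by
  have h : UnifSmoothAt z fun a w => ∑ α : Fin j → ι, ∑ β : Fin j → ι,
      (∏ s, (coordMetric G b (e a) w)⁻¹ (α s) (β s)) *
        covDeriv G b (e a) (f a) j α w * covDeriv G b (e a) (f a) j β w :=
    UnifSmoothAt.sum _ fun α => UnifSmoothAt.sum _ fun β =>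
      ((UnifSmoothAt.prod _ fun s => hG' _ _).mul (unifSmoothAt_covDeriv hG hG' hf j α)).mul
        (unifSmoothAt_covDeriv hG hG' hf j β)
  obtain ⟨C, hC⟩ := h.bounded
  refine ⟨Real.sqrt C, fun a => ?_⟩
  unfold covNorm
  rw [hp]
  exact Real.sqrt_le_sqrt ((le_abs_self _).trans (hC a))

/-- Vanishing is carried as a statement about germs, since the induction step differentiates. -/
theorem covDeriv_eventuallyEq_zero {e : OpenPartialHomeomorph M H} {f : M → ℝ} {w : E}
    (hf : (fun w => f ((e.extend I).symm w)) =ᶠ[𝓝 w] 0) (j : ℕ) (α : Fin j → ι) :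
    covDeriv G b e f j α =ᶠ[𝓝 w] 0 := by
  induction j with
  | zero => exact hf
  | succ j ih =>
    have h1 := ih (Fin.tail α)
    have h2 : ∀ᶠ w' in 𝓝 w, ∀ s : Fin j, ∀ k : ι,
        covDeriv G b e f j (Function.update (Fin.tail α) s k) w' = 0 :=
      eventually_all.2 fun s => eventually_all.2 fun k => ih _
    filter_upwards [h1.eventuallyEq_nhds, h2] with w' h1 h2
    have : fderiv ℝ (covDeriv G b e f j (Fin.tail α)) w' = 0 := by
      rw [h1.fderiv_eq]; exact fderiv_const_apply (0 : ℝ)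
    simp [covDeriv, coordDeriv, this, h2]

theorem covNorm_eq_zero {e : OpenPartialHomeomorph M H} {f : M → ℝ} {p : M}
    (hf : (fun w => f ((e.extend I).symm w)) =ᶠ[𝓝 (e.extend I p)] 0) (j : ℕ) :
    covNorm G b e f j p = 0 := by
  have h := fun α => (covDeriv_eventuallyEq_zero (G := G) (b := b) hf j α).eq_of_nhds
  simp only [covNorm, h, Pi.zero_apply, mul_zero, Finset.sum_const_zero, Real.sqrt_zero]

end CovariantBounds

/-! ### Rescaled product charts of the end. -/

section RescaledChart

variable {n : ℕ} {N : Type*} [TopologicalSpace N] [ChartedSpace (EuclideanSpace ℝ (Fin n)) N]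

/-- The chart `(y, r) ↦ (σ (φ y - v₀), r - r₀)` of `N × ℝ` obtained from a chart `φ` of `N`. -/
def rescaledChart (φ : OpenPartialHomeomorph N (EuclideanSpace ℝ (Fin n)))
    (v₀ : EuclideanSpace ℝ (Fin n)) (σ : ℝ) (hσ : σ ≠ 0) (r₀ : ℝ) :
    OpenPartialHomeomorph (N × ℝ) (ModelProd (EuclideanSpace ℝ (Fin n)) ℝ) :=
  (φ.transHomeomorph ((Homeomorph.subRight v₀).trans (Homeomorph.smulOfNeZero σ hσ))).prod
    (Homeomorph.subRight r₀).toOpenPartialHomeomorph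

variable {φ : OpenPartialHomeomorph N (EuclideanSpace ℝ (Fin n))}
  {v₀ : EuclideanSpace ℝ (Fin n)} {σ : ℝ} {hσ : σ ≠ 0} {r₀ : ℝ}

theorem rescaledChart_source :
    (rescaledChart φ v₀ σ hσ r₀).source = φ.source ×ˢ univ := by
  simp [rescaledChart]

theorem rescaledChart_target :
    (rescaledChart φ v₀ σ hσ r₀).target = {z | σ⁻¹ • z.1 + v₀ ∈ φ.target} := by
  ext z
  change (_ ∧ _) ↔ _
  simp only [OpenPartialHomeomorph.transHomeomorph]
  simp

theorem rescaledChart_extend_target :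
    ((rescaledChart φ v₀ σ hσ r₀).extend (endModel n)).target =
      {z | σ⁻¹ • z.1 + v₀ ∈ φ.target} := by
  rw [OpenPartialHomeomorph.extend_target, rescaledChart_target]
  ext z
  simp

variable [IsManifold (𝓡 n) ∞ N]

theorem rescaledChart_mem_maximalAtlas (hφ : φ ∈ IsManifold.maximalAtlas (𝓡 n) ∞ N) :
    rescaledChart φ v₀ σ hσ r₀ ∈ IsManifold.maximalAtlas (endModel n) ∞ (N × ℝ) := by
  have h1 : ContMDiffOn (𝓡 n) (𝓡 n) ∞ φ φ.source := contMDiffOn_of_mem_maximalAtlas hφ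
  have h2 : ContMDiffOn (𝓡 n) (𝓡 n) ∞ φ.symm φ.target := contMDiffOn_symm_of_mem_maximalAtlas hφ
  apply IsManifold.mem_maximalAtlas_prod
  · apply OpenPartialHomeomorph.mem_maximalAtlas_of_contMDiffOn
    · have h3 : ContMDiff (𝓡 n) (𝓡 n) ∞ fun v : EuclideanSpace ℝ (Fin n) => σ • (v - v₀) := by
        rw [contMDiff_iff_contDiff]; fun_prop
      exact h3.comp_contMDiffOn h1
    · have h3 : ContMDiff (𝓡 n) (𝓡 n) ∞ fun v : EuclideanSpace ℝ (Fin n) => σ⁻¹ • v + v₀ := by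
        rw [contMDiff_iff_contDiff]; fun_prop
      exact h2.comp h3.contMDiffOn fun v hv => by
        simpa [OpenPartialHomeomorph.transHomeomorph] using hv
  · apply OpenPartialHomeomorph.mem_maximalAtlas_of_contMDiffOn
    · have h3 : ContMDiff 𝓘(ℝ, ℝ) 𝓘(ℝ, ℝ) ∞ fun v : ℝ => v - r₀ := by
        rw [contMDiff_iff_contDiff]; fun_prop
      exact h3.contMDiffOn
    · have h3 : ContMDiff 𝓘(ℝ, ℝ) 𝓘(ℝ, ℝ) ∞ fun v : ℝ => v + r₀ := by
        rw [contMDiff_iff_contDiff]; fun_prop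
      exact h3.contMDiffOn

end RescaledChart

/-! ### The metrics `h` and `g₀` in coordinates. -/

section ChartForm

variable {n : ℕ} {N : Type*} [TopologicalSpace N] [ChartedSpace (EuclideanSpace ℝ (Fin n)) N]
  [IsManifold (𝓡 n) ∞ N] [RiemannianBundle (fun y : N => TangentSpace (𝓡 n) y)]
  {φ : OpenPartialHomeomorph N (EuclideanSpace ℝ (Fin n))}
  {v₀ : EuclideanSpace ℝ (Fin n)} {σ : ℝ} {hσ : σ ≠ 0} {r₀ : ℝ}

/-- The Riemannian metric of `N` in the chart `φ`. -/
def chartForm (φ : OpenPartialHomeomorph N (EuclideanSpace ℝ (Fin n)))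
    (v w w' : EuclideanSpace ℝ (Fin n)) : ℝ :=
  inner ℝ (mfderiv 𝓘(ℝ, EuclideanSpace ℝ (Fin n)) (𝓡 n) φ.symm v w)
    (mfderiv 𝓘(ℝ, EuclideanSpace ℝ (Fin n)) (𝓡 n) φ.symm v w')

theorem chartForm_add_left (v w₁ w₂ w' : EuclideanSpace ℝ (Fin n)) :
    chartForm φ v (w₁ + w₂) w' = chartForm φ v w₁ w' + chartForm φ v w₂ w' := by
  unfold chartForm
  erw [map_add]
  exact inner_add_left _ _ _

theorem chartForm_smul_left (t : ℝ) (v w w' : EuclideanSpace ℝ (Fin n)) :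
    chartForm φ v (t • w) w' = t * chartForm φ v w w' := by
  unfold chartForm
  erw [map_smul]
  exact real_inner_smul_left _ _ _

theorem chartForm_comm (v w w' : EuclideanSpace ℝ (Fin n)) :
    chartForm φ v w w' = chartForm φ v w' w :=
  real_inner_comm _ _

/-- The derivative of `φ.symm` is injective because `φ ∘ φ.symm` is locally the identity. -/
theorem chartForm_pos (hφ : φ ∈ IsManifold.maximalAtlas (𝓡 n) ∞ N)
    {v w : EuclideanSpace ℝ (Fin n)} (hv : v ∈ φ.target) (hw : w ≠ 0) :
    0 < chartForm φ v w w := by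
  refine real_inner_self_pos.2 fun h => hw ?_
  have h1 : MDifferentiableAt (𝓡 n) (𝓡 n) φ.symm v :=
    (contMDiffAt_symm_of_mem_maximalAtlas hφ hv).mdifferentiableAt (by simp)
  have h2 : MDifferentiableAt (𝓡 n) (𝓡 n) φ (φ.symm v) :=
    (contMDiffAt_of_mem_maximalAtlas hφ (φ.map_target hv)).mdifferentiableAt (by simp)
  have h3 := mfderiv_comp_apply v h2 h1 w
  have h4 : (φ ∘ φ.symm) =ᶠ[𝓝 v] id := φ.eventually_right_inverse hv
  rw [h4.mfderiv_eq, mfderiv_id] at h3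
  erw [h, map_zero] at h3
  exact h3

theorem contDiffOn_chartForm [IsContMDiffRiemannianBundle (𝓡 n) ∞ (EuclideanSpace ℝ (Fin n))
      (fun y : N => TangentSpace (𝓡 n) y)] (hφ : φ ∈ IsManifold.maximalAtlas (𝓡 n) ∞ N)
    (w w' : EuclideanSpace ℝ (Fin n)) :
    ContDiffOn ℝ ∞ (fun v => chartForm φ v w w') φ.target := by
  have h2 : ContMDiffOn (𝓡 n) (𝓡 n) ∞ φ.symm φ.target := contMDiffOn_symm_of_mem_maximalAtlas hφ
  -- The constant vector field `w` is pushed forward by the tangent map of `φ.symm`, giving a smooth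
  -- lift of `φ.symm` to the tangent bundle; the smooth bundle metric then applies to two such
  -- lifts.
  have key : ∀ w : EuclideanSpace ℝ (Fin n),
      ContMDiffOn (𝓡 n) ((𝓡 n).prod (𝓡 n)) ∞
        (fun v => (TotalSpace.mk' (EuclideanSpace ℝ (Fin n)) (φ.symm v)
          (mfderiv 𝓘(ℝ, EuclideanSpace ℝ (Fin n)) (𝓡 n) φ.symm v w) :
            TangentBundle (𝓡 n) N)) φ.target := fun w => by
    have h3 := h2.contMDiffOn_tangentMapWithin (m := ∞) (by simp) φ.open_target.uniqueMDiffOn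
    have h4 : ContMDiff (𝓡 n) ((𝓡 n).prod (𝓡 n)) ∞
        (fun v : EuclideanSpace ℝ (Fin n) => (⟨v, w⟩ : TangentBundle (𝓡 n) _)) := by
      intro v
      rw [contMDiffAt_totalSpace]
      refine ⟨contMDiffAt_id, ?_⟩
      simpa using contMDiffAt_const
    refine (h3.comp h4.contMDiffOn fun v hv => hv).congr fun v hv => ?_
    simp only [Function.comp_apply, tangentMapWithin]
    rw [mfderivWithin_of_isOpen φ.open_target hv]
  exact contMDiffOn_iff_contDiffOn.1 ((key w).inner_bundle (key w'))

/-- The parametrization contracts the directions of `N` by `σ⁻¹`, and this factor, squared, turns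
`θ²` into `(θ / σ)²`. -/
theorem warpedMetric_rescaledChart (hφ : φ ∈ IsManifold.maximalAtlas (𝓡 n) ∞ N) (θ : ℝ → ℝ)
    {z : EuclideanSpace ℝ (Fin n) × ℝ} (hz : σ⁻¹ • z.1 + v₀ ∈ φ.target)
    (w w' : EuclideanSpace ℝ (Fin n) × ℝ) :
    warpedMetric n θ (((rescaledChart φ v₀ σ hσ r₀).extend (endModel n)).symm z)
      (mfderiv 𝓘(ℝ, EuclideanSpace ℝ (Fin n) × ℝ) (endModel n)
        ((rescaledChart φ v₀ σ hσ r₀).extend (endModel n)).symm z w)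
      (mfderiv 𝓘(ℝ, EuclideanSpace ℝ (Fin n) × ℝ) (endModel n)
        ((rescaledChart φ v₀ σ hσ r₀).extend (endModel n)).symm z w') =
    w.2 * w'.2 + (θ (z.2 + r₀) / σ) ^ 2 * chartForm φ (σ⁻¹ • z.1 + v₀) w.1 w'.1 := by
  set S := ((rescaledChart φ v₀ σ hσ r₀).extend (endModel n)).symm
  have hS : MDifferentiableAt 𝓘(ℝ, EuclideanSpace ℝ (Fin n) × ℝ) (endModel n) S z := by
    have h := contMDiffOn_extend_symm (rescaledChart_mem_maximalAtlas (v₀ := v₀) (hσ := hσ)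
      (r₀ := r₀) hφ) z (by
        rw [← OpenPartialHomeomorph.extend_target', rescaledChart_extend_target]; exact hz)
    refine (h.contMDiffAt ?_).mdifferentiableAt (by simp)
    rw [← OpenPartialHomeomorph.extend_target', rescaledChart_extend_target]
    refine (φ.open_target.preimage ?_).mem_nhds hz
    fun_prop
  have hsnd : ∀ w, mfderiv (endModel n) 𝓘(ℝ, ℝ) Prod.snd (S z)
      (mfderiv 𝓘(ℝ, EuclideanSpace ℝ (Fin n) × ℝ) (endModel n) S z w) = w.2 := fun w => by
    rw [← mfderiv_comp_apply z mdifferentiableAt_snd hS w]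
    have : (Prod.snd ∘ S) = fun z => z.2 + r₀ := rfl
    rw [this, mfderiv_eq_fderiv]
    erw [fderiv_add_const, fderiv_snd]
    rfl
  have hfst : ∀ w, mfderiv (endModel n) (𝓡 n) Prod.fst (S z)
      (mfderiv 𝓘(ℝ, EuclideanSpace ℝ (Fin n) × ℝ) (endModel n) S z w) =
      σ⁻¹ • mfderiv 𝓘(ℝ, EuclideanSpace ℝ (Fin n)) (𝓡 n) φ.symm (σ⁻¹ • z.1 + v₀) w.1 := fun w => by
    rw [← mfderiv_comp_apply z mdifferentiableAt_fst hS w]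
    have h1 : MDifferentiableAt (𝓡 n) (𝓡 n) φ.symm (σ⁻¹ • z.1 + v₀) :=
      (contMDiffAt_symm_of_mem_maximalAtlas hφ hz).mdifferentiableAt (by simp)
    have : (Prod.fst ∘ S) =
      φ.symm ∘ fun z : EuclideanSpace ℝ (Fin n) × ℝ => σ⁻¹ • z.1 + v₀ := rfl
    have h2 : DifferentiableAt ℝ
      (fun z : EuclideanSpace ℝ (Fin n) × ℝ => σ⁻¹ • z.1 + v₀) z := by fun_prop
    have h3 : fderiv ℝ (fun z : EuclideanSpace ℝ (Fin n) × ℝ => σ⁻¹ • z.1 + v₀) z w = σ⁻¹ • w.1 := by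
      have h : HasFDerivAt (fun z : EuclideanSpace ℝ (Fin n) × ℝ => σ⁻¹ • z.1 + v₀)
        (σ⁻¹ • ContinuousLinearMap.fst ℝ (EuclideanSpace ℝ (Fin n)) ℝ) z :=
        (σ⁻¹ • ContinuousLinearMap.fst ℝ (EuclideanSpace ℝ (Fin n)) ℝ).hasFDerivAt.add_const v₀
      rw [h.fderiv]; rfl
    rw [this, mfderiv_comp_apply z (by exact h1) h2.mdifferentiableAt, mfderiv_eq_fderiv]
    erw [h3, map_smul]
  unfold warpedMetric
  refine congrArg₂ (· + ·) (congrArg₂ (· * ·) (hsnd w) (hsnd w')) ?_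
  refine (congrArg (θ (z.2 + r₀) ^ 2 * ·) (congrArg₂ (inner ℝ) (hfst w) (hfst w'))).trans ?_
  beta_reduce
  refine (congrArg (θ (z.2 + r₀) ^ 2 * ·) ((real_inner_smul_left _ _ _).trans
    (congrArg (σ⁻¹ * ·) (real_inner_smul_right _ _ _)))).trans ?_
  rw [div_pow, div_eq_mul_inv, ← inv_pow, chartForm]
  have h : ∀ a b x : ℝ, a * (b * (b * x)) = a * b ^ 2 * x := fun a b x => by ring
  exact h _ _ _

end ChartForm

/-! ### The metric matrix as a fixed function of finitely many bounded parameters. -/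

section BlockMetric

variable {n : ℕ} {N : Type*} [TopologicalSpace N] [ChartedSpace (EuclideanSpace ℝ (Fin n)) N]
  [IsManifold (𝓡 n) ∞ N] [RiemannianBundle (fun y : N => TangentSpace (𝓡 n) y)]
  {φ : OpenPartialHomeomorph N (EuclideanSpace ℝ (Fin n))}
  {v₀ : EuclideanSpace ℝ (Fin n)} {σ : ℝ} {hσ : σ ≠ 0} {r₀ : ℝ}

/-- The bilinear form `ds² + τ² h_v` on `ℝⁿ × ℝ`, where `h_v` is the metric of `N` in the chart `φ`
at the point with coordinates `v`. -/
def blockForm (φ : OpenPartialHomeomorph N (EuclideanSpace ℝ (Fin n)))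
    (q : ℝ × EuclideanSpace ℝ (Fin n)) :
    LinearMap.BilinForm ℝ (EuclideanSpace ℝ (Fin n) × ℝ) :=
  LinearMap.mk₂ ℝ (fun w w' => w.2 * w'.2 + q.1 ^ 2 * chartForm φ q.2 w.1 w'.1)
    (fun w w' w'' => by simp [chartForm_add_left]; ring)
    (fun c w w' => by simp [chartForm_smul_left]; ring)
    (fun w w' w'' => by
      simp only [chartForm_comm (φ := φ) q.2 w.1, Prod.fst_add, Prod.snd_add, chartForm_add_left]
      ring)
    (fun c w w' => by
      simp only [chartForm_comm (φ := φ) q.2 w.1, Prod.smul_fst, Prod.smul_snd, smul_eq_mul,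
        chartForm_smul_left]
      ring)

theorem blockForm_apply (q : ℝ × EuclideanSpace ℝ (Fin n))
    (w w' : EuclideanSpace ℝ (Fin n) × ℝ) :
    blockForm φ q w w' = w.2 * w'.2 + q.1 ^ 2 * chartForm φ q.2 w.1 w'.1 := rfl

/-- The matrix of `blockForm` in the standard basis. -/
def blockMatrix (φ : OpenPartialHomeomorph N (EuclideanSpace ℝ (Fin n)))
    (q : ℝ × EuclideanSpace ℝ (Fin n)) : Matrix (Fin n ⊕ Unit) (Fin n ⊕ Unit) ℝ :=
  Matrix.of fun i j => blockForm φ q (endBasis n i) (endBasis n j)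

/-- A kernel vector of the Gram matrix would be a nonzero vector `w` with `B w w = 0`. -/
theorem det_matrix_ne_zero_of_pos {E ι : Type*} [AddCommGroup E] [Module ℝ E] [Fintype ι]
    [DecidableEq ι] (b : Module.Basis ι ℝ E) (B : LinearMap.BilinForm ℝ E)
    (hB : ∀ w, w ≠ 0 → 0 < B w w) : (Matrix.of fun i j => B (b i) (b j)).det ≠ 0 := by
  intro h
  obtain ⟨x, hx, hx'⟩ := Matrix.exists_mulVec_eq_zero_iff.2 h
  have h0 : b.equivFun.symm x ≠ 0 := fun h => hx
    ((map_eq_zero_iff _ b.equivFun.symm.injective).1 h)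
  refine (hB _ h0).ne' ?_
  have h1 : ∀ i, B (b i) (b.equivFun.symm x) = 0 := fun i => by
    have h2 := congrFun hx' i
    simp only [Matrix.mulVec, dotProduct, Matrix.of_apply, Pi.zero_apply] at h2
    rw [b.equivFun_symm_apply, map_sum, ← h2]
    exact Finset.sum_congr rfl fun j _ => by rw [map_smul, smul_eq_mul, mul_comm]
  have h2 : B (b.equivFun.symm x) = ∑ i, x i • B (b i) := by
    rw [b.equivFun_symm_apply, map_sum]
    simp only [map_smul]
  rw [h2, LinearMap.sum_apply]
  exact Finset.sum_eq_zero fun i _ => by rw [LinearMap.smul_apply, h1, smul_zero]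

theorem det_blockMatrix_ne_zero (hφ : φ ∈ IsManifold.maximalAtlas (𝓡 n) ∞ N)
    {q : ℝ × EuclideanSpace ℝ (Fin n)} (hq : q.1 ≠ 0) (hq' : q.2 ∈ φ.target) :
    (blockMatrix φ q).det ≠ 0 := by
  refine det_matrix_ne_zero_of_pos _ _ fun w hw => ?_
  rw [blockForm_apply]
  have h2 : 0 < q.1 ^ 2 := by positivity
  by_cases h : w.1 = 0
  · have h3 : w.2 ≠ 0 := fun h' => hw (Prod.ext h h')
    have h4 : chartForm φ q.2 w.1 w.1 = 0 := by
      rw [h]; simpa using chartForm_smul_left (φ := φ) 0 q.2 0 0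
    have := mul_self_pos.2 h3
    rw [h4]; linarith
  · have := mul_pos h2 (chartForm_pos hφ hq' h)
    linarith [mul_self_nonneg w.2]

variable [IsContMDiffRiemannianBundle (𝓡 n) ∞ (EuclideanSpace ℝ (Fin n))
      (fun y : N => TangentSpace (𝓡 n) y)]

theorem contDiffOn_blockMatrix (hφ : φ ∈ IsManifold.maximalAtlas (𝓡 n) ∞ N)
    (i j : Fin n ⊕ Unit) :
    ContDiffOn ℝ ∞ (fun q => blockMatrix φ q i j) ({0}ᶜ ×ˢ φ.target) := by
  simp only [blockMatrix, Matrix.of_apply, blockForm_apply]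
  refine contDiffOn_const.add ((contDiff_fst.pow 2).contDiffOn.mul ?_)
  exact (contDiffOn_chartForm hφ _ _).comp contDiff_snd.contDiffOn fun q hq => hq.2

theorem contDiffOn_det {E ι : Type*} [NormedAddCommGroup E] [NormedSpace ℝ E] [Fintype ι]
    [DecidableEq ι] {B : E → Matrix ι ι ℝ} {s : Set E}
    (hB : ∀ i j, ContDiffOn ℝ ∞ (fun q => B q i j) s) : ContDiffOn ℝ ∞ (fun q => (B q).det) s := by
  simp only [Matrix.det_apply']
  exact ContDiffOn.sum fun τ _ => contDiffOn_const.mul (contDiffOn_prod fun i _ => hB _ _)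

theorem contDiffOn_matrix_inv {E ι : Type*} [NormedAddCommGroup E] [NormedSpace ℝ E] [Fintype ι]
    [DecidableEq ι] {B : E → Matrix ι ι ℝ} {s : Set E}
    (hB : ∀ i j, ContDiffOn ℝ ∞ (fun q => B q i j) s) (h : ∀ q ∈ s, (B q).det ≠ 0) (i j : ι) :
    ContDiffOn ℝ ∞ (fun q => (B q)⁻¹ i j) s := by
  simp only [Matrix.inv_def, Matrix.smul_apply, Ring.inverse_eq_inv', smul_eq_mul,
    Matrix.adjugate_apply]
  refine ((contDiffOn_det hB).inv h).mul (contDiffOn_det fun k l => ?_)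
  by_cases hk : k = j
  · subst hk; simp only [Matrix.updateRow_self]; exact contDiffOn_const
  · simp only [Matrix.updateRow_ne hk]; exact hB k l

/-- The center, the scale and the height enter only through the argument of `blockMatrix`. Uniform
bounds on the metric thus reduce to this argument being uniformly smooth with values in a compact
set. -/
theorem coordMetric_rescaledChart (hφ : φ ∈ IsManifold.maximalAtlas (𝓡 n) ∞ N) (θ : ℝ → ℝ)
    {z : EuclideanSpace ℝ (Fin n) × ℝ} (hz : σ⁻¹ • z.1 + v₀ ∈ φ.target) :
    coordMetric (warpedMetric n θ) (endBasis n) (rescaledChart φ v₀ σ hσ r₀) z =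
      blockMatrix φ (θ (z.2 + r₀) / σ, σ⁻¹ • z.1 + v₀) := by
  ext i j
  exact warpedMetric_rescaledChart hφ θ hz _ _

/-- On a compact subset of the target of a chart, the Riemannian metric is comparable with the
Euclidean one. -/
theorem exists_chartForm_bounds (hφ : φ ∈ IsManifold.maximalAtlas (𝓡 n) ∞ N)
    {K : Set (EuclideanSpace ℝ (Fin n))} (hK : IsCompact K) (hKφ : K ⊆ φ.target) :
    ∃ κ : ℝ, 1 ≤ κ ∧ ∀ v ∈ K, ∀ w,
      ‖w‖ ^ 2 ≤ κ * chartForm φ v w w ∧ chartForm φ v w w ≤ κ * ‖w‖ ^ 2 := by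
  have hcont : ContinuousOn (fun q : EuclideanSpace ℝ (Fin n) × EuclideanSpace ℝ (Fin n) =>
      chartForm φ q.1 q.2 q.2) (φ.target ×ˢ univ) := by
    have h : ∀ v w, chartForm φ v w w = ∑ i, ∑ j, w i * w j *
        chartForm φ v (EuclideanSpace.single i 1) (EuclideanSpace.single j 1) := fun v w => by
      have hw : w = ∑ i, w i • EuclideanSpace.single i (1 : ℝ) := by
        have := (EuclideanSpace.basisFun (Fin n) ℝ).sum_repr w
        simpa using this.symm
      let B : LinearMap.BilinForm ℝ (EuclideanSpace ℝ (Fin n)) := LinearMap.mk₂ ℝ (chartForm φ v)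
        (chartForm_add_left v) (fun c => chartForm_smul_left c v)
        (fun a b c => by
          simp only [chartForm_comm (φ := φ) v a, chartForm_add_left])
        (fun a b c => by
          simp only [chartForm_comm (φ := φ) v b, chartForm_smul_left, smul_eq_mul])
      have h1 : B w w = ∑ i, ∑ j, w i * w j *
          B (EuclideanSpace.single i 1) (EuclideanSpace.single j 1) := by
        conv_lhs => rw [hw]
        simp only [map_sum, LinearMap.sum_apply, map_smul, LinearMap.smul_apply, smul_eq_mul]
        rw [Finset.sum_comm]
        exact Finset.sum_congr rfl fun i _ => by
          rw [Finset.mul_sum]; exact Finset.sum_congr rfl fun j _ => by ring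
      exact h1
    simp only [h]
    refine continuousOn_finsetSum _ fun i _ => continuousOn_finsetSum _ fun j _ => ?_
    refine ContinuousOn.mul (by fun_prop) ?_
    exact (contDiffOn_chartForm hφ _ _).continuousOn.comp continuousOn_fst fun q hq => hq.1
  -- By homogeneity it suffices to bound the form and its inverse on unit vectors, a compact set on
  -- which the form is continuous and positive.
  have hS : IsCompact (K ×ˢ Metric.sphere (0 : EuclideanSpace ℝ (Fin n)) 1) :=
    hK.prod (isCompact_sphere _ _)
  have hsub : K ×ˢ Metric.sphere (0 : EuclideanSpace ℝ (Fin n)) 1 ⊆ φ.target ×ˢ univ :=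
    prod_mono hKφ (subset_univ _)
  have hpos : ∀ q ∈ K ×ˢ Metric.sphere (0 : EuclideanSpace ℝ (Fin n)) 1,
      0 < chartForm φ q.1 q.2 q.2 := fun q hq => by
    refine chartForm_pos hφ (hKφ hq.1) fun h => ?_
    have := hq.2
    simp [h] at this
  obtain ⟨C₁, hC₁⟩ := hS.exists_bound_of_continuousOn (hcont.mono hsub)
  obtain ⟨C₂, hC₂⟩ := hS.exists_bound_of_continuousOn
    ((hcont.mono hsub).inv₀ fun q hq => (hpos q hq).ne')
  refine ⟨max 1 (max C₁ C₂), le_max_left _ _, fun v hv w => ?_⟩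
  by_cases hw : w = 0
  · have h4 : chartForm φ v w w = 0 := by
      rw [hw]; simpa using chartForm_smul_left (φ := φ) 0 v 0 0
    rw [h4, hw]; simp
  · have hn : 0 < ‖w‖ := norm_pos_iff.2 hw
    set u := ‖w‖⁻¹ • w with hu
    have hu1 : (v, u) ∈ K ×ˢ Metric.sphere (0 : EuclideanSpace ℝ (Fin n)) 1 := by
      refine ⟨hv, ?_⟩
      simp [hu, norm_smul, hn.ne']
    have hwu : chartForm φ v w w = ‖w‖ ^ 2 * chartForm φ v u u := by
      have : w = ‖w‖ • u := by rw [hu, smul_smul, mul_inv_cancel₀ hn.ne', one_smul]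
      conv_lhs => rw [this]
      rw [chartForm_smul_left, chartForm_comm, chartForm_smul_left]
      ring
    have hp := hpos _ hu1
    have h1 := hC₁ _ hu1
    have h2 := hC₂ _ hu1
    simp only [Real.norm_eq_abs, abs_inv, abs_of_pos hp, Pi.inv_apply] at h1 h2 hp
    have h1' : chartForm φ v u u ≤ max 1 (max C₁ C₂) :=
      h1.trans ((le_max_left _ _).trans (le_max_right _ _))
    have h2' : 1 ≤ max 1 (max C₁ C₂) * chartForm φ v u u := by
      have := (inv_le_iff_one_le_mul₀ hp).1 h2
      refine this.trans (mul_le_mul_of_nonneg_right ?_ hp.le)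
      exact (le_max_right _ _).trans (le_max_right _ _)
    rw [hwu]
    have hsq : 0 < ‖w‖ ^ 2 := by positivity
    constructor <;> nlinarith

end BlockMetric

/-! ### The scaling function at bounded distances. -/

section Scaling

variable {θ : ℝ → ℝ}

theorem IsSubconicScaling.contDiffAt (hθ : IsSubconicScaling θ) {r : ℝ} (hr : 1 < r) :
    ContDiffAt ℝ ∞ θ r := hθ.smooth.contDiffAt (Ici_mem_nhds hr)

theorem IsSubconicScaling.exists_iteratedDeriv_le (hθ : IsSubconicScaling θ) {m : ℕ}
    (hm : 1 ≤ m) : ∃ C : ℝ, ∀ r, 1 < r → |iteratedDeriv m θ r| ≤ C := by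
  obtain ⟨C, hC⟩ := hθ.bounded m hm
  refine ⟨C, fun r hr => ?_⟩
  rw [← iteratedDerivWithin_eq_iteratedDeriv (uniqueDiffOn_Ici 1)
    ((hθ.contDiffAt hr).of_le (by exact_mod_cast le_top)) (mem_Ici.2 hr.le)]
  exact hC r hr.le

/-- At bounded distances the scaling function changes by a factor at most `2`. -/
theorem IsSubconicScaling.exists_le_two_mul (hθ : IsSubconicScaling θ) (D B : ℝ) :
    ∃ R : ℝ, 1 < R ∧ ∀ r, R ≤ r → B ≤ θ r ∧ ∀ s, R ≤ s → |r - s| ≤ D → θ r ≤ 2 * θ s := by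
  obtain ⟨C, hC⟩ := hθ.bounded 1 le_rfl
  -- Beyond `R` the possible increment `C * D` of `θ` over a distance `D` is at most the value of
  -- `θ` itself.
  obtain ⟨R, hR⟩ := eventually_atTop.1 (hθ.tendsto.eventually_ge_atTop (max B (C * D)))
  refine ⟨max R 2, lt_of_lt_of_le one_lt_two (le_max_right _ _), fun r hr => ?_⟩
  have hr2 : 2 ≤ r := (le_max_right _ _).trans hr
  refine ⟨(le_max_left _ _).trans (hR r ((le_max_left _ _).trans hr)), fun s hs hrs => ?_⟩
  have hs2 : 2 ≤ s := (le_max_right _ _).trans hs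
  have hCs := (le_max_right _ _).trans (hR s ((le_max_left _ _).trans hs))
  have hdiff : DifferentiableOn ℝ θ (Ici 1) := hθ.smooth.differentiableOn (by simp)
  have h := (convex_Ici (1 : ℝ)).norm_image_sub_le_of_norm_derivWithin_le (f := θ) (C := C) hdiff
    (fun x hx => by simpa [iteratedDerivWithin_one] using hC x hx)
    (show s ∈ Ici 1 from by simp only [mem_Ici]; linarith)
    (show r ∈ Ici 1 from by simp only [mem_Ici]; linarith)
  have hC0 : 0 ≤ C := (abs_nonneg _).trans (hC 1 le_rfl)
  have h2 : θ r - θ s ≤ C * D := by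
    refine (le_abs_self _).trans (h.trans (mul_le_mul_of_nonneg_left ?_ hC0))
    exact hrs
  linarith

variable {A E : Type*} [NormedAddCommGroup E] [NormedSpace ℝ E] {z : A → E}

/-- Order zero is the hypothesis `hD`; in higher orders the derivatives of `θ` are bounded and
division by `σ ≥ 1` does no harm. -/
theorem IsSubconicScaling.unifSmoothAt (hθ : IsSubconicScaling θ) {t r σ : A → ℝ}
    (ht : ∀ a, 1 < t a + r a) (hσ : ∀ a, 1 ≤ σ a) {D : ℝ} (hD : ∀ a, θ (t a + r a) ≤ D * σ a) :
    UnifSmoothAt t fun a x => θ (x + r a) / σ a := by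
  have hcomp : ∀ a, ContDiffAt ℝ ∞ (fun x => θ (x + r a)) (t a) := fun a =>
    (hθ.contDiffAt (ht a)).comp (t a) (contDiffAt_id.add contDiffAt_const)
  refine ⟨fun a => (hcomp a).div_const _, fun k => ?_⟩
  have hσ' : ∀ a, |(σ a)⁻¹| ≤ 1 := fun a => by
    rw [abs_inv, abs_of_pos (lt_of_lt_of_le one_pos (hσ a))]
    exact inv_le_one_of_one_le₀ (hσ a)
  rcases Nat.eq_zero_or_pos k with rfl | hk
  · refine ⟨D, fun a => ?_⟩
    have hσp : 0 < σ a := lt_of_lt_of_le one_pos (hσ a)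
    rw [norm_iteratedFDeriv_zero, Real.norm_eq_abs, abs_of_pos (div_pos (hθ.pos _ (ht a).le) hσp),
      div_le_iff₀ hσp]
    exact hD a
  · obtain ⟨C, hC⟩ := hθ.exists_iteratedDeriv_le hk
    refine ⟨C, fun a => ?_⟩
    rw [norm_iteratedFDeriv_eq_norm_iteratedDeriv]
    simp only [div_eq_inv_mul]
    rw [iteratedDeriv_const_mul_field, iteratedDeriv_comp_add_const, norm_mul]
    calc _ ≤ 1 * C := mul_le_mul (hσ' a) (hC _ (ht a)) (abs_nonneg _) zero_le_one
      _ = C := one_mul _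

end Scaling

/-! ### The radial bump and its gradient. -/

section Bump

variable {V : Type*} [NormedAddCommGroup V] [InnerProductSpace ℝ V]

/-- The squared Euclidean norm on `V × ℝ`. -/
def sqNorm (z : V × ℝ) : ℝ := ‖z.1‖ ^ 2 + z.2 ^ 2

theorem sqNorm_nonneg (z : V × ℝ) : 0 ≤ sqNorm z := by unfold sqNorm; positivity

theorem sqNorm_smul (t : ℝ) (z : V × ℝ) : sqNorm (t • z) = t ^ 2 * sqNorm z := by
  simp only [sqNorm, Prod.smul_fst, Prod.smul_snd, norm_smul, smul_eq_mul, mul_pow,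
    Real.norm_eq_abs, sq_abs]
  ring

theorem contDiff_sqNorm : ContDiff ℝ ∞ (sqNorm : V × ℝ → ℝ) :=
  (contDiff_fst.norm_sq ℝ).add (contDiff_snd.pow 2)

/-- The norm of `V × ℝ` is the maximum norm, which is not smooth; `sqNorm` replaces it, and this
comparison gives compactness and boundedness. -/
theorem norm_sq_le_sqNorm (z : V × ℝ) : ‖z‖ ^ 2 ≤ sqNorm z := by
  rw [Prod.norm_def]
  unfold sqNorm
  rcases max_cases ‖z.1‖ ‖z.2‖ with ⟨h, _⟩ | ⟨h, _⟩ <;> rw [h]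
  · nlinarith [sq_nonneg z.2]
  · rw [Real.norm_eq_abs, sq_abs]; nlinarith [sq_nonneg ‖z.1‖]

/-- Euler's identity for a function homogeneous of degree two. -/
theorem fderiv_sqNorm_self (z : V × ℝ) : fderiv ℝ sqNorm z z = 2 * sqNorm z := by
  have h1 : HasFDerivAt (sqNorm : V × ℝ → ℝ) (fderiv ℝ sqNorm z) z :=
    (contDiff_sqNorm.differentiable (by simp) z).hasFDerivAt
  have h1' : HasFDerivAt (sqNorm : V × ℝ → ℝ) (fderiv ℝ sqNorm z) ((1 : ℝ) • z) := by
    rwa [one_smul]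
  have h2 : HasDerivAt (fun t : ℝ => t • z) z 1 := by
    simpa using (hasDerivAt_id (1 : ℝ)).smul_const z
  have h3 : HasDerivAt (fun t : ℝ => sqNorm (t • z)) (fderiv ℝ sqNorm z z) 1 :=
    HasFDerivAt.comp_hasDerivAt (f := fun t : ℝ => t • z) (1 : ℝ) h1' h2
  have h4 : HasDerivAt (fun t : ℝ => sqNorm (t • z)) (2 * sqNorm z) 1 := by
    simp only [sqNorm_smul]
    simpa using (hasDerivAt_pow 2 (1 : ℝ)).mul_const (sqNorm z)
  exact h3.unique h4

/-- A smooth radial function on `V × ℝ` with maximum `3` at the origin, positive exactly on the ball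
of radius `T`, and without critical points in this ball apart from the origin. -/
def radialBump (T : ℝ) (z : V × ℝ) : ℝ :=
  3 * Real.exp 1 * expNegInvGlue (1 - sqNorm z / T ^ 2)

theorem contDiff_radialBump (T : ℝ) : ContDiff ℝ ∞ (radialBump T : V × ℝ → ℝ) :=
  contDiff_const.mul (expNegInvGlue.contDiff.comp (contDiff_const.sub (contDiff_sqNorm.div_const _)))

theorem radialBump_nonneg (T : ℝ) (z : V × ℝ) : 0 ≤ radialBump T z :=
  mul_nonneg (by positivity) (expNegInvGlue.nonneg _)

theorem radialBump_eq_zero {T : ℝ} (hT : 0 < T) {z : V × ℝ} (hz : T ^ 2 ≤ sqNorm z) :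
    radialBump T z = 0 := by
  have : 1 ≤ sqNorm z / T ^ 2 := by rwa [le_div_iff₀ (by positivity), one_mul]
  rw [radialBump, expNegInvGlue.zero_of_nonpos (by linarith), mul_zero]

theorem radialBump_eq_exp {T : ℝ} (hT : 0 < T) {z : V × ℝ} (hz : sqNorm z < T ^ 2) :
    radialBump T z = 3 * Real.exp (1 - (1 - sqNorm z / T ^ 2)⁻¹) := by
  have : sqNorm z / T ^ 2 < 1 := by rwa [div_lt_one (by positivity)]
  rw [radialBump, expNegInvGlue, if_neg (by linarith), mul_assoc, ← Real.exp_add]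
  ring_nf

theorem radialBump_le {T : ℝ} (hT : 0 < T) (z : V × ℝ) : radialBump T z ≤ 3 := by
  rcases le_or_gt (T ^ 2) (sqNorm z) with h | h
  · rw [radialBump_eq_zero hT h]; norm_num
  · rw [radialBump_eq_exp hT h]
    have h1 : sqNorm z / T ^ 2 < 1 := by rwa [div_lt_one (by positivity)]
    have h2 : 0 ≤ sqNorm z / T ^ 2 := div_nonneg (sqNorm_nonneg z) (by positivity)
    have h3 : 1 ≤ (1 - sqNorm z / T ^ 2)⁻¹ := (one_le_inv₀ (by linarith)).2 (by linarith)
    have : Real.exp (1 - (1 - sqNorm z / T ^ 2)⁻¹) ≤ 1 := Real.exp_le_one_iff.2 (by linarith)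
    linarith

/-- At radius `T / 4` the exponent is at least `1 - 16/15 = -1/15`, and `3 (1 - 1/15) ≥ 2`. -/
theorem two_le_radialBump {T : ℝ} (hT : 0 < T) {z : V × ℝ} (hz : sqNorm z ≤ (T / 4) ^ 2) :
    2 ≤ radialBump T z := by
  have hT2 : 0 < T ^ 2 := by positivity
  have h1 : sqNorm z / T ^ 2 ≤ 1 / 16 := by rw [div_le_iff₀ hT2]; linarith [hz, div_pow T 4 2]
  rw [radialBump_eq_exp hT (by nlinarith)]
  have h3 : (1 - sqNorm z / T ^ 2)⁻¹ ≤ 16 / 15 := by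
    rw [inv_le_comm₀ (by linarith) (by norm_num)]; linarith
  have := Real.add_one_le_exp (1 - (1 - sqNorm z / T ^ 2)⁻¹)
  linarith

theorem radialBump_zero (T : ℝ) : radialBump T (0 : V × ℝ) = 3 := by
  have h : sqNorm (0 : V × ℝ) = 0 := by simp [sqNorm]
  rw [radialBump, h, expNegInvGlue]
  norm_num
  rw [mul_assoc, ← Real.exp_add]
  norm_num

theorem sqNorm_lt_of_radialBump_pos {T : ℝ} (hT : 0 < T) {z : V × ℝ} (hz : 0 < radialBump T z) :
    sqNorm z < T ^ 2 := by
  by_contra! h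
  exact hz.ne' (radialBump_eq_zero hT h)

/-- With `x = 1 - sqNorm z / T²` in `(0, 1]`, the inward radial derivative is the bump times `x⁻²`
times `2 sqNorm z / T²`, and the first two factors are at least `1`. -/
theorem le_neg_fderiv_radialBump {T : ℝ} (hT : 0 < T) {z : V × ℝ} (hz : 1 ≤ radialBump T z) :
    2 * sqNorm z / T ^ 2 ≤ -fderiv ℝ (radialBump T) z z := by
  have hz' := sqNorm_lt_of_radialBump_pos hT (lt_of_lt_of_le one_pos hz)
  have hT2 : 0 < T ^ 2 := by positivity
  set x := 1 - sqNorm z / T ^ 2 with hx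
  have h1 : sqNorm z / T ^ 2 < 1 := by rwa [div_lt_one (by positivity)]
  have h2 : 0 ≤ sqNorm z / T ^ 2 := div_nonneg (sqNorm_nonneg z) (by positivity)
  have hx0 : 0 < x := by linarith
  have hx1 : x ≤ 1 := by linarith
  have hg : HasDerivAt expNegInvGlue (Real.exp (-x⁻¹) * (x ^ 2)⁻¹) x := by
    have h : HasDerivAt (fun t : ℝ => Real.exp (-t⁻¹)) (Real.exp (-x⁻¹) * (x ^ 2)⁻¹) x := by
      simpa using (hasDerivAt_inv hx0.ne').neg.exp
    refine h.congr_of_eventuallyEq ?_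
    filter_upwards [lt_mem_nhds hx0] with t ht
    rw [expNegInvGlue, if_neg (by linarith)]
  have hs : HasFDerivAt (sqNorm : V × ℝ → ℝ) (fderiv ℝ sqNorm z) z :=
    (contDiff_sqNorm.differentiable (by simp) z).hasFDerivAt
  have hq : HasFDerivAt (fun z : V × ℝ => 1 - sqNorm z / T ^ 2)
      (-((T ^ 2)⁻¹ • fderiv ℝ sqNorm z)) z := by
    simp only [div_eq_inv_mul]
    exact (hs.const_mul _).const_sub _
  have hb : HasFDerivAt (radialBump T : V × ℝ → ℝ) ((3 * Real.exp 1) •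
      ((Real.exp (-x⁻¹) * (x ^ 2)⁻¹) • (-((T ^ 2)⁻¹ • fderiv ℝ sqNorm z)))) z :=
    (hg.comp_hasFDerivAt z hq).const_mul _
  have hval : radialBump T z = 3 * Real.exp 1 * Real.exp (-x⁻¹) := by
    rw [radialBump, expNegInvGlue, if_neg (by linarith)]
  have : -fderiv ℝ (radialBump T) z z =
      radialBump T z * ((x ^ 2)⁻¹ * (2 * sqNorm z / T ^ 2)) := by
    rw [hb.fderiv, hval]
    simp only [smul_apply, neg_apply, fderiv_sqNorm_self,
      smul_eq_mul]
    ring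
  rw [this]
  have h3 : 1 ≤ (x ^ 2)⁻¹ := (one_le_inv₀ (by positivity)).2 (by nlinarith)
  have h4 : 0 ≤ 2 * sqNorm z / T ^ 2 := by have := sqNorm_nonneg z; positivity
  have h5 : 2 * sqNorm z / T ^ 2 ≤ (x ^ 2)⁻¹ * (2 * sqNorm z / T ^ 2) := le_mul_of_one_le_left h4 h3
  exact h5.trans (le_mul_of_one_le_left (h4.trans h5) hz)

theorem radialBump_eq_comp_smul {T : ℝ} (z : V × ℝ) :
    radialBump T z = radialBump 1 (T⁻¹ • z) := by
  rw [radialBump, radialBump, sqNorm_smul]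
  congr 3
  rw [inv_pow]; ring

theorem fderiv_radialBump (T : ℝ) (z w : V × ℝ) :
    fderiv ℝ (radialBump T) z w = T⁻¹ * fderiv ℝ (radialBump 1) (T⁻¹ • z) w := by
  have h2 : (radialBump T : V × ℝ → ℝ) = fun z => radialBump 1 (T⁻¹ • z) := by
    ext1 z; exact radialBump_eq_comp_smul z
  rw [h2, fderiv_comp_smul, smul_apply, smul_eq_mul]

theorem exists_norm_fderiv_le_of_hasCompactSupport {E : Type*} [NormedAddCommGroup E]
    [NormedSpace ℝ E] {f : E → ℝ} (hf : ContDiff ℝ ∞ f) (h : HasCompactSupport f) :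
    ∃ C : ℝ, ∀ z, ‖fderiv ℝ f z‖ ≤ C :=
  (h.fderiv (𝕜 := ℝ)).exists_bound_of_continuous (hf.continuous_fderiv (by simp))

/-- Rescaling reduces to radius `1`, where the support is compact. It matters that `C` does not
depend on `T`: a radius will later be chosen in terms of this constant. -/
theorem exists_abs_fderiv_radialBump_le [ProperSpace V] :
    ∃ C : ℝ, 0 < C ∧ ∀ T : ℝ, 0 < T → ∀ z w : V × ℝ,
      |fderiv ℝ (radialBump T) z w| ≤ C / T * Real.sqrt (sqNorm w) := by
  have hsupp : HasCompactSupport (radialBump 1 : V × ℝ → ℝ) := by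
    refine HasCompactSupport.intro (isCompact_closedBall (0 : V × ℝ) 1) fun z hz => ?_
    refine radialBump_eq_zero one_pos ?_
    have h : 1 < ‖z‖ := by simpa using hz
    nlinarith [norm_sq_le_sqNorm z]
  obtain ⟨C, hC⟩ := exists_norm_fderiv_le_of_hasCompactSupport (contDiff_radialBump 1) hsupp
  refine ⟨max C 1, by positivity, fun T hT z w => ?_⟩
  rw [fderiv_radialBump, abs_mul, abs_inv, abs_of_pos hT]
  have h3 : |fderiv ℝ (radialBump 1) (T⁻¹ • z) w| ≤ max C 1 * Real.sqrt (sqNorm w) := by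
    refine ((fderiv ℝ (radialBump 1) (T⁻¹ • z)).le_opNorm w).trans ?_
    refine mul_le_mul ((hC _).trans (le_max_left _ _)) ?_ (norm_nonneg _) (by positivity)
    exact Real.le_sqrt_of_sq_le (norm_sq_le_sqNorm w)
  calc _ ≤ T⁻¹ * (max C 1 * Real.sqrt (sqNorm w)) := by gcongr
    _ = _ := by ring

end Bump

/-! ### Uniform geometry in rescaled coordinates around good centers. -/

section EndCoordinates

variable {n : ℕ} {N : Type*} [TopologicalSpace N] [ChartedSpace (EuclideanSpace ℝ (Fin n)) N]
  {φ : OpenPartialHomeomorph N (EuclideanSpace ℝ (Fin n))}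
  {v₀ : EuclideanSpace ℝ (Fin n)} {σ : ℝ} {r₀ : ℝ}

/-- The coordinates `(σ (φ y - v₀), r - r₀)` of the point `(y, r)`. -/
def endCoord (φ : OpenPartialHomeomorph N (EuclideanSpace ℝ (Fin n)))
    (v₀ : EuclideanSpace ℝ (Fin n)) (σ r₀ : ℝ) (p : N × ℝ) : EuclideanSpace ℝ (Fin n) × ℝ :=
  (σ • (φ p.1 - v₀), p.2 - r₀)

/-- The local parametrization inverse to `endCoord`. -/
def endParam (φ : OpenPartialHomeomorph N (EuclideanSpace ℝ (Fin n)))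
    (v₀ : EuclideanSpace ℝ (Fin n)) (σ r₀ : ℝ) (z : EuclideanSpace ℝ (Fin n) × ℝ) : N × ℝ :=
  (φ.symm (σ⁻¹ • z.1 + v₀), z.2 + r₀)

theorem endCoord_endParam (hσ : σ ≠ 0) {z : EuclideanSpace ℝ (Fin n) × ℝ}
    (hz : σ⁻¹ • z.1 + v₀ ∈ φ.target) : endCoord φ v₀ σ r₀ (endParam φ v₀ σ r₀ z) = z := by
  simp only [endCoord, endParam, φ.right_inv hz]
  refine Prod.ext ?_ ?_
  · simp [smul_smul, hσ]
  · simp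

theorem endCoord_fst_mem (hσ : σ ≠ 0) (p : N × ℝ) :
    σ⁻¹ • (endCoord φ v₀ σ r₀ p).1 + v₀ = φ p.1 := by
  simp [endCoord, smul_smul, hσ]

theorem endParam_endCoord (hσ : σ ≠ 0) {p : N × ℝ} (hp : p.1 ∈ φ.source) :
    endParam φ v₀ σ r₀ (endCoord φ v₀ σ r₀ p) = p := by
  rw [endParam, endCoord_fst_mem hσ, φ.left_inv hp]
  simp [endCoord]

variable [IsManifold (𝓡 n) ∞ N]

theorem contMDiffAt_endParam (hφ : φ ∈ IsManifold.maximalAtlas (𝓡 n) ∞ N)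
    {z : EuclideanSpace ℝ (Fin n) × ℝ} (hz : σ⁻¹ • z.1 + v₀ ∈ φ.target) :
    ContMDiffAt 𝓘(ℝ, EuclideanSpace ℝ (Fin n) × ℝ) (endModel n) ∞ (endParam φ v₀ σ r₀) z := by
  have h1 : ContMDiffAt (𝓡 n) (𝓡 n) ∞ φ.symm (σ⁻¹ • z.1 + v₀) :=
    contMDiffAt_symm_of_mem_maximalAtlas hφ hz
  have h2 : ContMDiffAt 𝓘(ℝ, EuclideanSpace ℝ (Fin n) × ℝ) (𝓡 n) ∞
      (fun z : EuclideanSpace ℝ (Fin n) × ℝ => σ⁻¹ • z.1 + v₀) z := by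
    refine ContDiff.contMDiff ?_ z
    fun_prop
  have h3 : ContMDiffAt 𝓘(ℝ, EuclideanSpace ℝ (Fin n) × ℝ) 𝓘(ℝ, ℝ) ∞
      (fun z : EuclideanSpace ℝ (Fin n) × ℝ => z.2 + r₀) z := by
    refine ContDiff.contMDiff ?_ z
    fun_prop
  exact (ContMDiffAt.comp z h1 h2).prodMk h3

theorem contMDiffAt_endCoord (hφ : φ ∈ IsManifold.maximalAtlas (𝓡 n) ∞ N)
    {p : N × ℝ} (hp : p.1 ∈ φ.source) :
    ContMDiffAt (endModel n) 𝓘(ℝ, EuclideanSpace ℝ (Fin n) × ℝ) ∞ (endCoord φ v₀ σ r₀) p := by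
  have h1 : ContMDiffAt (endModel n) (𝓡 n) ∞ (fun p : N × ℝ => φ p.1) p :=
    ContMDiffAt.comp p (contMDiffAt_of_mem_maximalAtlas hφ hp) contMDiffAt_fst
  have h2 : ContMDiffAt (endModel n) (𝓡 n) ∞ (fun p : N × ℝ => σ • (φ p.1 - v₀)) p := by
    have h : ContDiff ℝ ∞ fun v : EuclideanSpace ℝ (Fin n) => σ • (v - v₀) := by fun_prop
    exact h.contMDiff.contMDiffAt.comp p h1
  have h3 : ContMDiffAt (endModel n) 𝓘(ℝ, ℝ) ∞ (fun p : N × ℝ => p.2 - r₀) p := by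
    have h : ContDiff ℝ ∞ fun v : ℝ => v - r₀ := by fun_prop
    exact h.contMDiff.contMDiffAt.comp p contMDiffAt_snd
  exact h2.prodMk_space h3

theorem isOpen_endParam_domain :
    IsOpen {z : EuclideanSpace ℝ (Fin n) × ℝ | σ⁻¹ • z.1 + v₀ ∈ φ.target} :=
  φ.open_target.preimage (by fun_prop)

/-- The derivative has a left inverse and acts between spaces of equal dimension. Estimates for
tangent vectors can thus be checked on coordinate vectors. -/
theorem mfderiv_endParam_surjective (hφ : φ ∈ IsManifold.maximalAtlas (𝓡 n) ∞ N) (hσ : σ ≠ 0)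
    {z : EuclideanSpace ℝ (Fin n) × ℝ} (hz : σ⁻¹ • z.1 + v₀ ∈ φ.target)
    (v : TangentSpace (endModel n) (endParam φ v₀ σ r₀ z)) :
    ∃ w : EuclideanSpace ℝ (Fin n) × ℝ,
      mfderiv 𝓘(ℝ, EuclideanSpace ℝ (Fin n) × ℝ) (endModel n) (endParam φ v₀ σ r₀) z w = v := by
  have h1 := (contMDiffAt_endParam (r₀ := r₀) hφ hz).mdifferentiableAt (by simp)
  have h2 := (contMDiffAt_endCoord (v₀ := v₀) (σ := σ) (r₀ := r₀) (p := endParam φ v₀ σ r₀ z) hφ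
    (φ.map_target hz)).mdifferentiableAt (by simp)
  have h3 : endCoord φ v₀ σ r₀ ∘ endParam φ v₀ σ r₀ =ᶠ[𝓝 z] id := by
    filter_upwards [isOpen_endParam_domain.mem_nhds hz] with z' hz'
    exact endCoord_endParam hσ hz'
  let D : EuclideanSpace ℝ (Fin n) × ℝ →L[ℝ] EuclideanSpace ℝ (Fin n) × ℝ :=
    mfderiv 𝓘(ℝ, EuclideanSpace ℝ (Fin n) × ℝ) (endModel n) (endParam φ v₀ σ r₀) z
  have hinj : Function.Injective D := by
    refine Function.LeftInverse.injective (g := mfderiv (endModel n)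
      𝓘(ℝ, EuclideanSpace ℝ (Fin n) × ℝ) (endCoord φ v₀ σ r₀) (endParam φ v₀ σ r₀ z)) fun w => ?_
    have h4 := mfderiv_comp_apply z h2 h1 w
    rw [h3.mfderiv_eq, mfderiv_id] at h4
    exact h4.symm
  exact (LinearMap.injective_iff_surjective (f := D.toLinearMap)).1 hinj v

variable [RiemannianBundle (fun y : N => TangentSpace (𝓡 n) y)]

theorem warpedMetric_endParam (hφ : φ ∈ IsManifold.maximalAtlas (𝓡 n) ∞ N) (hσ : σ ≠ 0)
    (θ : ℝ → ℝ) {z : EuclideanSpace ℝ (Fin n) × ℝ} (hz : σ⁻¹ • z.1 + v₀ ∈ φ.target)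
    (w : EuclideanSpace ℝ (Fin n) × ℝ) :
    warpedMetric n θ (endParam φ v₀ σ r₀ z)
      (mfderiv 𝓘(ℝ, EuclideanSpace ℝ (Fin n) × ℝ) (endModel n) (endParam φ v₀ σ r₀) z w)
      (mfderiv 𝓘(ℝ, EuclideanSpace ℝ (Fin n) × ℝ) (endModel n) (endParam φ v₀ σ r₀) z w) =
    w.2 ^ 2 + (θ (z.2 + r₀) / σ) ^ 2 * chartForm φ (σ⁻¹ • z.1 + v₀) w.1 w.1 := by
  rw [sq w.2]
  -- `endParam` is by definition the inverse of the extended `rescaledChart`.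
  exact warpedMetric_rescaledChart (hσ := hσ) hφ θ hz w w

theorem mfderiv_apply_endParam (hφ : φ ∈ IsManifold.maximalAtlas (𝓡 n) ∞ N) (hσ : σ ≠ 0)
    {z : EuclideanSpace ℝ (Fin n) × ℝ} (hz : σ⁻¹ • z.1 + v₀ ∈ φ.target) {f : N × ℝ → ℝ}
    {b : EuclideanSpace ℝ (Fin n) × ℝ → ℝ} (hb : ContDiff ℝ ∞ b)
    (hf : f =ᶠ[𝓝 (endParam φ v₀ σ r₀ z)] b ∘ endCoord φ v₀ σ r₀)
    (w : EuclideanSpace ℝ (Fin n) × ℝ) :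
    mfderiv (endModel n) 𝓘(ℝ, ℝ) f (endParam φ v₀ σ r₀ z)
      (mfderiv 𝓘(ℝ, EuclideanSpace ℝ (Fin n) × ℝ) (endModel n) (endParam φ v₀ σ r₀) z w) =
    fderiv ℝ b z w := by
  have h1 := (contMDiffAt_endParam (r₀ := r₀) hφ hz)
  have h2 := (contMDiffAt_endCoord (v₀ := v₀) (σ := σ) (r₀ := r₀) (p := endParam φ v₀ σ r₀ z) hφ
    (φ.map_target hz))
  have h3 : MDifferentiableAt (endModel n) 𝓘(ℝ, ℝ) f (endParam φ v₀ σ r₀ z) := by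
    have := (hb.contMDiff.contMDiffAt.comp _ h2).congr_of_eventuallyEq hf
    exact this.mdifferentiableAt (by simp)
  refine (mfderiv_comp_apply z h3 (h1.mdifferentiableAt (by simp)) w).symm.trans ?_
  have h4 : f ∘ endParam φ v₀ σ r₀ =ᶠ[𝓝 z] b := by
    filter_upwards [isOpen_endParam_domain.mem_nhds hz, h1.continuousAt.eventually hf] with z' hz' h
    rw [Function.comp_apply, h, Function.comp_apply, endCoord_endParam hσ hz']
  rw [h4.mfderiv_eq, mfderiv_eq_fderiv]
  rfl

/-- The point with coordinate `v₀` and height `r₀` is a good center at scale `T` if the rescaled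
coordinates of radius `2 T` around it stay in the region over `K` in which the scaling function
varies by a factor at most `2`. -/
structure IsGoodCenter (θ : ℝ → ℝ) (K : Set (EuclideanSpace ℝ (Fin n))) (T : ℝ)
    (v₀ : EuclideanSpace ℝ (Fin n)) (r₀ : ℝ) : Prop where
  one_le : 1 ≤ θ r₀
  mem : ∀ z : EuclideanSpace ℝ (Fin n) × ℝ, sqNorm z < (2 * T) ^ 2 → (θ r₀)⁻¹ • z.1 + v₀ ∈ K
  one_lt : ∀ z : EuclideanSpace ℝ (Fin n) × ℝ, sqNorm z < (2 * T) ^ 2 → 1 < z.2 + r₀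
  le_two_mul : ∀ z : EuclideanSpace ℝ (Fin n) × ℝ, sqNorm z < (2 * T) ^ 2 →
    θ (z.2 + r₀) ≤ 2 * θ r₀ ∧ θ r₀ ≤ 2 * θ (z.2 + r₀)

variable {θ : ℝ → ℝ} {K : Set (EuclideanSpace ℝ (Fin n))} {T : ℝ}

theorem IsGoodCenter.ne_zero (h : IsGoodCenter θ K T v₀ r₀) : θ r₀ ≠ 0 :=
  (lt_of_lt_of_le one_pos h.one_le).ne'

theorem IsGoodCenter.ratio_mem (h : IsGoodCenter θ K T v₀ r₀)
    {z : EuclideanSpace ℝ (Fin n) × ℝ} (hz : sqNorm z < (2 * T) ^ 2) :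
    θ (z.2 + r₀) / θ r₀ ∈ Icc (1 / 2 : ℝ) 2 := by
  have h0 : 0 < θ r₀ := lt_of_lt_of_le one_pos h.one_le
  have h1 := h.le_two_mul z hz
  exact ⟨by rw [le_div_iff₀ h0]; linarith, by rw [div_le_iff₀ h0]; exact h1.1⟩

/-- The factor `4` comes from the squared ratio of scales, which lies in `[1/4, 4]`; `κ` accounts
for `h`. -/
theorem IsGoodCenter.metric_bounds (h : IsGoodCenter θ K T v₀ r₀)
    (hφ : φ ∈ IsManifold.maximalAtlas (𝓡 n) ∞ N) (hK : K ⊆ φ.target) {κ : ℝ} (hκ1 : 1 ≤ κ)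
    (hκ : ∀ v ∈ K, ∀ w, ‖w‖ ^ 2 ≤ κ * chartForm φ v w w ∧ chartForm φ v w w ≤ κ * ‖w‖ ^ 2)
    {z : EuclideanSpace ℝ (Fin n) × ℝ} (hz : sqNorm z < (2 * T) ^ 2)
    (w : EuclideanSpace ℝ (Fin n) × ℝ) :
    sqNorm w ≤ 4 * κ * warpedMetric n θ (endParam φ v₀ (θ r₀) r₀ z)
      (mfderiv 𝓘(ℝ, EuclideanSpace ℝ (Fin n) × ℝ) (endModel n) (endParam φ v₀ (θ r₀) r₀) z w)
      (mfderiv 𝓘(ℝ, EuclideanSpace ℝ (Fin n) × ℝ) (endModel n) (endParam φ v₀ (θ r₀) r₀) z w) ∧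
    warpedMetric n θ (endParam φ v₀ (θ r₀) r₀ z)
      (mfderiv 𝓘(ℝ, EuclideanSpace ℝ (Fin n) × ℝ) (endModel n) (endParam φ v₀ (θ r₀) r₀) z w)
      (mfderiv 𝓘(ℝ, EuclideanSpace ℝ (Fin n) × ℝ) (endModel n) (endParam φ v₀ (θ r₀) r₀) z w) ≤
      4 * κ * sqNorm w := by
  rw [warpedMetric_endParam hφ h.ne_zero θ (hK (h.mem z hz))]
  obtain ⟨h1, h2⟩ := hκ _ (h.mem z hz) w.1
  obtain ⟨h3, h4⟩ := h.ratio_mem hz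
  set τ := θ (z.2 + r₀) / θ r₀
  set H := chartForm φ ((θ r₀)⁻¹ • z.1 + v₀) w.1 w.1
  have hH : 0 ≤ κ * H := (sq_nonneg _).trans h1
  have hH0 : 0 ≤ H := nonneg_of_mul_nonneg_right hH (by linarith)
  have h5 : 1 / 4 ≤ τ ^ 2 := by nlinarith
  have h6 : τ ^ 2 ≤ 4 := by nlinarith
  unfold sqNorm
  have h7 : 1 / 4 * H ≤ τ ^ 2 * H := mul_le_mul_of_nonneg_right h5 hH0
  have h8 : τ ^ 2 * H ≤ 4 * H := mul_le_mul_of_nonneg_right h6 hH0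
  have h9 : w.2 ^ 2 ≤ κ * w.2 ^ 2 := le_mul_of_one_le_left (sq_nonneg _) hκ1
  have h10 : κ * (1 / 4 * H) ≤ κ * (τ ^ 2 * H) := mul_le_mul_of_nonneg_left h7 (by linarith)
  constructor <;> nlinarith [sq_nonneg w.2]

theorem exists_isGoodCenter (hθ : IsSubconicScaling θ) (T δ : ℝ) (hT : 0 < T) (hδ : 0 < δ) :
    ∃ R : ℝ, 1 < R ∧ ∀ r₀ v₀ (K : Set (EuclideanSpace ℝ (Fin n))), R ≤ r₀ →
      Metric.closedBall v₀ δ ⊆ K → IsGoodCenter θ K T v₀ r₀ := by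
  obtain ⟨R, hR1, hR⟩ := hθ.exists_le_two_mul (2 * T) (max 1 (2 * T / δ))
  -- The margin `2 * T` keeps all heights in the ball above `R`. The bound `θ r₀ ≥ 2 * T / δ` makes
  -- the ball, of radius `2 * T` in rescaled coordinates, fit into the `δ`-ball of the chart.
  refine ⟨R + 2 * T, by linarith, fun r₀ v₀ K hr hK => ?_⟩
  have h1 := (hR r₀ (by linarith)).1
  have hone : 1 ≤ θ r₀ := (le_max_left _ _).trans h1
  have hTδ : 2 * T / δ ≤ θ r₀ := (le_max_right _ _).trans h1
  rw [div_le_iff₀ hδ] at hTδ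
  have key : ∀ z : EuclideanSpace ℝ (Fin n) × ℝ, sqNorm z < (2 * T) ^ 2 →
      ‖z.1‖ ≤ 2 * T ∧ |z.2| ≤ 2 * T := fun z hz => by
    unfold sqNorm at hz
    exact ⟨abs_le_of_sq_le_sq' (by nlinarith [sq_nonneg z.2]) (by linarith) |>.2,
      abs_le_of_sq_le_sq (by nlinarith [sq_nonneg ‖z.1‖]) (by linarith)⟩
  refine ⟨hone, fun z hz => hK ?_, fun z hz => ?_, fun z hz => ?_⟩
  · rw [Metric.mem_closedBall, dist_eq_norm, add_sub_cancel_right, norm_smul, norm_inv,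
      Real.norm_eq_abs, abs_of_pos (by linarith), inv_mul_le_iff₀ (by linarith)]
    exact (key z hz).1.trans hTδ
  · have := abs_le.1 (key z hz).2
    linarith
  · have h2 := abs_le.1 (key z hz).2
    refine ⟨(hR _ (by linarith)).2 _ (by linarith) ?_, (hR _ (by linarith)).2 _ (by linarith) ?_⟩
    · rw [add_sub_cancel_right]; exact (key z hz).2
    · rw [sub_add_cancel_right, abs_neg]; exact (key z hz).2

theorem IsGoodCenter.abs_mfderiv_le (h : IsGoodCenter θ K T v₀ r₀) (hT : 0 < T)
    (hφ : φ ∈ IsManifold.maximalAtlas (𝓡 n) ∞ N) (hK : K ⊆ φ.target) {κ : ℝ} (hκ1 : 1 ≤ κ)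
    (hκ : ∀ v ∈ K, ∀ w, ‖w‖ ^ 2 ≤ κ * chartForm φ v w w ∧ chartForm φ v w w ≤ κ * ‖w‖ ^ 2)
    {C : ℝ} (hC0 : 0 < C) (hC : ∀ T : ℝ, 0 < T → ∀ z w : EuclideanSpace ℝ (Fin n) × ℝ,
      |fderiv ℝ (radialBump T) z w| ≤ C / T * Real.sqrt (sqNorm w))
    {z : EuclideanSpace ℝ (Fin n) × ℝ} (hz : sqNorm z < (2 * T) ^ 2) {f : N × ℝ → ℝ}
    (hf : f =ᶠ[𝓝 (endParam φ v₀ (θ r₀) r₀ z)] radialBump T ∘ endCoord φ v₀ (θ r₀) r₀)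
    (v : TangentSpace (endModel n) (endParam φ v₀ (θ r₀) r₀ z)) :
    |(show ℝ from mfderiv (endModel n) 𝓘(ℝ, ℝ) f (endParam φ v₀ (θ r₀) r₀ z) v)| ≤
      C / T * Real.sqrt (4 * κ * warpedMetric n θ (endParam φ v₀ (θ r₀) r₀ z) v v) := by
  obtain ⟨w, rfl⟩ := mfderiv_endParam_surjective hφ h.ne_zero (hK (h.mem z hz)) v
  have h1 := mfderiv_apply_endParam hφ h.ne_zero (hK (h.mem z hz)) (contDiff_radialBump T) hf w
  have h2 : ∀ {x y c : ℝ}, x = y → |y| ≤ c → |x| ≤ c := fun hxy h => by rwa [hxy]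
  exact h2 h1 ((hC T hT z w).trans (mul_le_mul_of_nonneg_left
    (Real.sqrt_le_sqrt (h.metric_bounds hφ hK hκ1 hκ hz w).1) (by positivity)))

theorem IsGoodCenter.le_gradNorm (h : IsGoodCenter θ K T v₀ r₀) (hT : 0 < T)
    (hφ : φ ∈ IsManifold.maximalAtlas (𝓡 n) ∞ N) (hK : K ⊆ φ.target) {κ : ℝ} (hκ1 : 1 ≤ κ)
    (hκ : ∀ v ∈ K, ∀ w, ‖w‖ ^ 2 ≤ κ * chartForm φ v w w ∧ chartForm φ v w w ≤ κ * ‖w‖ ^ 2)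
    {ε : ℝ} (hε : 0 < ε) {z : EuclideanSpace ℝ (Fin n) × ℝ} (hz : 1 ≤ radialBump T z)
    (hzε : ε ^ 2 ≤ sqNorm z) {f : N × ℝ → ℝ}
    (hf : f =ᶠ[𝓝 (endParam φ v₀ (θ r₀) r₀ z)] radialBump T ∘ endCoord φ v₀ (θ r₀) r₀) :
    ε / (T ^ 2 * Real.sqrt κ) ≤
      gradNorm (warpedMetric n θ) f (endParam φ v₀ (θ r₀) r₀ z) := by
  have hzT : sqNorm z < (2 * T) ^ 2 := by
    have := sqNorm_lt_of_radialBump_pos hT (lt_of_lt_of_le one_pos hz)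
    nlinarith
  obtain ⟨C, hC0, hC⟩ := exists_abs_fderiv_radialBump_le (V := EuclideanSpace ℝ (Fin n))
  set p := endParam φ v₀ (θ r₀) r₀ z with hp
  -- A real supremum has the default value `0` on unbounded sets, so boundedness is needed before a
  -- single test vector can bound `gradNorm` from below.
  have hbdd : BddAbove {s : ℝ | ∃ v : TangentSpace (endModel n) p, warpedMetric n θ p v v ≤ 1 ∧
      s = (show ℝ from mfderiv (endModel n) 𝓘(ℝ, ℝ) f p v)} := by
    refine ⟨C / T * Real.sqrt (4 * κ), ?_⟩
    rintro s ⟨v, hv, rfl⟩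
    refine (le_abs_self _).trans ((h.abs_mfderiv_le hT hφ hK hκ1 hκ hC0 hC hzT hf v).trans ?_)
    refine mul_le_mul_of_nonneg_left (Real.sqrt_le_sqrt ?_) (by positivity)
    exact mul_le_of_le_one_right (by linarith) hv
  have hs0 : 0 < sqNorm z := lt_of_lt_of_le (by positivity) hzε
  set s := Real.sqrt (sqNorm z) with hs
  have hs1 : s ^ 2 = sqNorm z := Real.sq_sqrt hs0.le
  have hspos : 0 < s := Real.sqrt_pos.2 hs0
  set k := Real.sqrt κ with hk
  have hk1 : k ^ 2 = κ := Real.sq_sqrt (by linarith)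
  have hkpos : 0 < k := Real.sqrt_pos.2 (by linarith)
  -- The test vector points radially inwards and has `sqNorm w = 1 / (4 * κ)`, so its `g₀`-length is
  -- at most `1`.
  set w : EuclideanSpace ℝ (Fin n) × ℝ := (-(2 * k * s)⁻¹) • z with hw
  have hsw : 4 * κ * sqNorm w = 1 := by
    rw [hw, sqNorm_smul, ← hs1, ← hk1]
    field_simp
    norm_num
  have h1 := mfderiv_apply_endParam hφ h.ne_zero (hK (h.mem z hzT)) (contDiff_radialBump T) hf w
  have h2 : fderiv ℝ (radialBump T) z w = (2 * k * s)⁻¹ * -fderiv ℝ (radialBump T) z z := by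
    rw [hw, map_smul, smul_eq_mul]; ring
  refine le_trans ?_ (le_csSup hbdd ⟨_, (h.metric_bounds hφ hK hκ1 hκ hzT w).2.trans hsw.le, rfl⟩)
  have hle : ∀ {x y c : ℝ}, x = y → c ≤ y → c ≤ x := fun hxy h => by rwa [hxy]
  refine hle (h1.trans h2) ?_
  have h3 := le_neg_fderiv_radialBump hT hz
  have hεs : ε ≤ s := Real.le_sqrt_of_sq_le hzε
  calc ε / (T ^ 2 * k) ≤ s / (T ^ 2 * k) := by gcongr
    _ = (2 * k * s)⁻¹ * (2 * sqNorm z / T ^ 2) := by rw [← hs1]; field_simp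
    _ ≤ _ := by gcongr

variable [IsContMDiffRiemannianBundle (𝓡 n) ∞ (EuclideanSpace ℝ (Fin n))
      (fun y : N => TangentSpace (𝓡 n) y)]

theorem exists_covNorm_radialBump_le (hθ : IsSubconicScaling θ) (hT : 0 < T)
    (hφ : φ ∈ IsManifold.maximalAtlas (𝓡 n) ∞ N) (hKc : IsCompact K) (hK : K ⊆ φ.target) (j : ℕ) :
    ∃ C : ℝ, ∀ v₀ r₀, IsGoodCenter θ K T v₀ r₀ → ∀ p : N × ℝ, p.1 ∈ φ.source →
      sqNorm (endCoord φ v₀ (θ r₀) r₀ p) < (2 * T) ^ 2 → ∀ f : N × ℝ → ℝ,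
      f =ᶠ[𝓝 p] radialBump T ∘ endCoord φ v₀ (θ r₀) r₀ →
      ∃ e ∈ IsManifold.maximalAtlas (endModel n) ∞ (N × ℝ),
        p ∈ e.source ∧ covNorm (warpedMetric n θ) (endBasis n) e f j p ≤ C := by
  -- All admissible centers, points and functions form one index type, so that a bound uniform over
  -- it is the constant sought.
  let A := {a : EuclideanSpace ℝ (Fin n) × ℝ × (N × ℝ) × (N × ℝ → ℝ) //
    IsGoodCenter θ K T a.1 a.2.1 ∧ a.2.2.1.1 ∈ φ.source ∧
    sqNorm (endCoord φ a.1 (θ a.2.1) a.2.1 a.2.2.1) < (2 * T) ^ 2 ∧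
    a.2.2.2 =ᶠ[𝓝 a.2.2.1] radialBump T ∘ endCoord φ a.1 (θ a.2.1) a.2.1}
  let v : A → EuclideanSpace ℝ (Fin n) := fun a => a.1.1
  let r : A → ℝ := fun a => a.1.2.1
  let p : A → N × ℝ := fun a => a.1.2.2.1
  let f : A → N × ℝ → ℝ := fun a => a.1.2.2.2
  have hgood : ∀ a : A, IsGoodCenter θ K T (v a) (r a) := fun a => a.2.1
  let e : A → OpenPartialHomeomorph (N × ℝ) (ModelProd (EuclideanSpace ℝ (Fin n)) ℝ) := fun a =>
    rescaledChart φ (v a) (θ (r a)) (hgood a).ne_zero (r a)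
  let z : A → EuclideanSpace ℝ (Fin n) × ℝ := fun a => endCoord φ (v a) (θ (r a)) (r a) (p a)
  have hz : ∀ a, sqNorm (z a) < (2 * T) ^ 2 := fun a => a.2.2.2.1
  have hzb : ∀ a, ‖z a‖ ≤ 2 * T := fun a =>
    abs_le_of_sq_le_sq' ((norm_sq_le_sqNorm _).trans (hz a).le) (by linarith) |>.2
  have hzK : ∀ a, (θ (r a))⁻¹ • (z a).1 + v a ∈ K := fun a => (hgood a).mem _ (hz a)
  let q : A → EuclideanSpace ℝ (Fin n) × ℝ → ℝ × EuclideanSpace ℝ (Fin n) := fun a w =>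
    (θ (w.2 + r a) / θ (r a), (θ (r a))⁻¹ • w.1 + v a)
  have hq : UnifSmoothAt z q := by
    have h1 : UnifSmoothAt z fun a w => θ (w.2 + r a) / θ (r a) := by
      have h2 : UnifSmoothAt z fun _ w => w.2 :=
        UnifSmoothAt.clm (ContinuousLinearMap.snd ℝ _ ℝ) ⟨_, hzb⟩
      refine UnifSmoothAt.comp (g := fun a x => θ (x + r a) / θ (r a)) ?_ h2
      exact hθ.unifSmoothAt (fun a => (hgood a).one_lt _ (hz a)) (fun a => (hgood a).one_le)
        (fun a => ((hgood a).le_two_mul _ (hz a)).1)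
    have h3 : UnifSmoothAt z fun a w => (θ (r a))⁻¹ • w.1 := by
      have h4 : UnifSmoothAt z fun _ w => w.1 :=
        UnifSmoothAt.clm (ContinuousLinearMap.fst ℝ _ ℝ) ⟨_, hzb⟩
      exact h4.const_smul ⟨1, fun a => by
        rw [abs_inv, abs_of_pos (lt_of_lt_of_le one_pos (hgood a).one_le)]
        exact inv_le_one_of_one_le₀ (hgood a).one_le⟩
    exact h1.prodMk (h3.add_const (hKc.isBounded.exists_norm_le.imp fun C hC a => hC _ (hzK a)))
  have hqK : ∀ a, q a (z a) ∈ Icc (1 / 2 : ℝ) 2 ×ˢ K := fun a =>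
    ⟨(hgood a).ratio_mem (hz a), hzK a⟩
  have hcpt : IsCompact (Icc (1 / 2 : ℝ) 2 ×ˢ K) := isCompact_Icc.prod hKc
  have hopen : IsOpen (({0}ᶜ : Set ℝ) ×ˢ φ.target) := isOpen_compl_singleton.prod φ.open_target
  have hsub : Icc (1 / 2 : ℝ) 2 ×ˢ K ⊆ ({0}ᶜ : Set ℝ) ×ˢ φ.target := by
    refine prod_mono (fun x hx => ?_) hK
    have := hx.1
    simp only [mem_compl_iff, mem_singleton_iff]
    intro h; rw [h] at this; norm_num at this
  have hmetric : ∀ a, (fun w => coordMetric (warpedMetric n θ) (endBasis n) (e a) w) =ᶠ[𝓝 (z a)]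
      fun w => blockMatrix φ (q a w) := fun a => by
    filter_upwards [isOpen_endParam_domain.mem_nhds (hK (hzK a))] with w hw
    exact coordMetric_rescaledChart hφ θ hw
  have hG : ∀ k l, UnifSmoothAt z fun a w =>
      coordMetric (warpedMetric n θ) (endBasis n) (e a) w k l := fun k l => by
    refine UnifSmoothAt.congr (u := fun a w => blockMatrix φ (q a w) k l) ?_
      fun a => (hmetric a).mono fun w hw => congrFun (congrFun hw k) l
    exact UnifSmoothAt.comp (g := fun _ x => blockMatrix φ x k l)
      (UnifSmoothAt.of_isCompact hopen (contDiffOn_blockMatrix hφ k l) hcpt hsub hqK) hq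
  have hG' : ∀ k l, UnifSmoothAt z fun a w =>
      (coordMetric (warpedMetric n θ) (endBasis n) (e a) w)⁻¹ k l := fun k l => by
    refine UnifSmoothAt.congr (u := fun a w => (blockMatrix φ (q a w))⁻¹ k l) ?_
      fun a => (hmetric a).mono fun w hw => congrArg (fun B => B⁻¹ k l) hw
    refine UnifSmoothAt.comp (g := fun _ x => (blockMatrix φ x)⁻¹ k l)
      (UnifSmoothAt.of_isCompact hopen ?_ hcpt hsub hqK) hq
    exact contDiffOn_matrix_inv (contDiffOn_blockMatrix hφ)
      (fun x hx => det_blockMatrix_ne_zero hφ hx.1 hx.2) k l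
  have hf : UnifSmoothAt z fun a w => f a (((e a).extend (endModel n)).symm w) := by
    refine UnifSmoothAt.congr (u := fun _ w => radialBump T w) ?_ fun a => ?_
    · exact UnifSmoothAt.of_isCompact isOpen_univ (contDiff_radialBump T).contDiffOn
        (isCompact_closedBall 0 (2 * T)) (subset_univ _) fun a => by simpa using hzb a
    · have h1 : endParam φ (v a) (θ (r a)) (r a) (z a) = p a :=
        endParam_endCoord (hgood a).ne_zero a.2.2.1
      have h2 : ContinuousAt (endParam φ (v a) (θ (r a)) (r a)) (z a) :=
        (contMDiffAt_endParam hφ (hK (hzK a))).continuousAt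
      have h3 : ∀ᶠ x in 𝓝 (endParam φ (v a) (θ (r a)) (r a) (z a)),
          f a x = (radialBump T ∘ endCoord φ (v a) (θ (r a)) (r a)) x := by
        rw [h1]; exact a.2.2.2.2
      filter_upwards [isOpen_endParam_domain.mem_nhds (hK (hzK a)), h2.eventually h3] with w hw h
      refine h.trans ?_
      rw [Function.comp_apply, endCoord_endParam (hgood a).ne_zero hw]
  obtain ⟨C, hC⟩ := exists_covNorm_le (p := p) (z := z) (e := e) (f := f) (fun a => rfl) hG hG' hf j
  refine ⟨C, fun v₀ r₀ hgood p hp hz f hf => ⟨_, rescaledChart_mem_maximalAtlas hφ, ?_,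
    hC ⟨⟨v₀, r₀, p, f⟩, hgood, hp, hz, hf⟩⟩⟩
  rw [rescaledChart_source]
  exact ⟨hp, mem_univ _⟩

end EndCoordinates

/-! ### Riemannian distance: lengths of curves and Lipschitz functions. -/

section RiemannianDistance

open MeasureTheory
open scoped NNReal

variable {E : Type*} [NormedAddCommGroup E] [NormedSpace ℝ E]
  {H : Type*} [TopologicalSpace H] {I : ModelWithCorners ℝ E H}
  {M : Type*} [PseudoEMetricSpace M] [ChartedSpace H M]
  [RiemannianBundle (fun x : M => TangentSpace I x)] [IsRiemannianManifold I M]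

theorem edist_le_of_norm_mfderiv_le {γ : ℝ → M} (hγ : ContMDiffOn 𝓘(ℝ, ℝ) I 1 γ (Icc 0 1))
    {C : ℝ} (hC : ∀ t ∈ Ioo (0 : ℝ) 1, ‖mfderiv 𝓘(ℝ, ℝ) I γ t (1 : ℝ)‖ ≤ C) :
    edist (γ 0) (γ 1) ≤ ENNReal.ofReal C := by
  rw [IsRiemannianManifold.out (I := I) (γ 0) (γ 1)]
  refine (riemannianEDist_le_pathELength hγ rfl rfl zero_le_one).trans ?_
  rw [pathELength_eq_lintegral_mfderiv_Ioo]
  calc _ ≤ ∫⁻ _ in Ioo (0 : ℝ) 1, ENNReal.ofReal C := by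
        refine setLIntegral_mono' measurableSet_Ioo fun t ht => ?_
        rw [← ofReal_norm]
        exact ENNReal.ofReal_le_ofReal (hC t ht)
    _ = ENNReal.ofReal C := by simp

/-- The strict inequality yields a curve of length below `D`; its image under `F` has length at most
`B * D`. No minimizing geodesic is needed. -/
theorem edist_le_mul_of_abs_mfderiv_le {F : M → ℝ} (hF : ContMDiff I 𝓘(ℝ, ℝ) 1 F) {B : ℝ≥0}
    (hB : ∀ m (v : TangentSpace I m), |(show ℝ from mfderiv I 𝓘(ℝ, ℝ) F m v)| ≤ B * ‖v‖)
    {x y : M} {D : ℝ≥0∞} (hxy : edist x y < D) : edist (F x) (F y) ≤ B * D := by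
  rw [IsRiemannianManifold.out (I := I) x y] at hxy
  obtain ⟨γ, rfl, rfl, hγ, hD⟩ := exists_lt_of_riemannianEDist_lt hxy
  rw [IsRiemannianManifold.out (I := 𝓘(ℝ, ℝ)) (F (γ 0)) (F (γ 1))]
  refine (riemannianEDist_le_pathELength (γ := F ∘ γ) (hF.comp_contMDiffOn hγ) rfl rfl
    zero_le_one).trans ?_
  rw [pathELength_eq_lintegral_mfderiv_Ioo] at hD ⊢
  refine le_trans ?_ (mul_le_mul_right hD.le (B : ℝ≥0∞))
  rw [← lintegral_const_mul' _ _ ENNReal.coe_ne_top]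
  refine setLIntegral_mono' measurableSet_Ioo fun t ht => ?_
  have h1 : MDifferentiableAt 𝓘(ℝ, ℝ) I γ t :=
    (hγ.contMDiffAt (Icc_mem_nhds ht.1 ht.2)).mdifferentiableAt one_ne_zero
  have h2 : MDifferentiableAt I 𝓘(ℝ, ℝ) F (γ t) := (hF (γ t)).mdifferentiableAt one_ne_zero
  rw [mfderiv_comp_apply t h2 h1, enorm_tangentSpace_vectorSpace,
    ← ofReal_norm (mfderiv 𝓘(ℝ, ℝ) I γ t 1)]
  have h3 : ∀ {x b : ℝ}, |x| ≤ B * b → ‖x‖ₑ ≤ B * ENNReal.ofReal b := fun h => by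
    rw [← ofReal_norm, ← ENNReal.ofReal_coe_nnreal, ← ENNReal.ofReal_mul (by positivity)]
    exact ENNReal.ofReal_le_ofReal h
  exact h3 (hB _ _)

end RiemannianDistance

/-! ### Comparison of the distance of `M` with rescaled coordinates. -/

section EndDistance

variable {n : ℕ} {N : Type*} [TopologicalSpace N] [T2Space N]
  [ChartedSpace (EuclideanSpace ℝ (Fin n)) N]
  [IsManifold (𝓡 n) ∞ N] [RiemannianBundle (fun y : N => TangentSpace (𝓡 n) y)]
  {M : Type*} [EMetricSpace M] [ChartedSpace (EuclideanSpace ℝ (Fin (n + 1))) M]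
  [IsManifold (𝓡 (n + 1)) ∞ M] [RiemannianBundle (fun x : M => TangentSpace (𝓡 (n + 1)) x)]
  [IsRiemannianManifold (𝓡 (n + 1)) M]
  {Φ : PartialDiffeomorph (endModel n) (𝓡 (n + 1)) (N × ℝ) M ∞}
  {φ : OpenPartialHomeomorph N (EuclideanSpace ℝ (Fin n))}
  {v₀ : EuclideanSpace ℝ (Fin n)} {r₀ : ℝ}
  {θ : ℝ → ℝ} {K : Set (EuclideanSpace ℝ (Fin n))} {T : ℝ}

theorem mfderiv_partialDiffeomorph_surjective {p : N × ℝ} (hp : p ∈ Φ.source)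
    (v : TangentSpace (𝓡 (n + 1)) (Φ p)) :
    ∃ w : TangentSpace (endModel n) p, mfderiv (endModel n) (𝓡 (n + 1)) Φ p w = v := by
  have h1 : MDifferentiableAt (endModel n) (𝓡 (n + 1)) Φ p := Φ.mdifferentiableAt (by simp) hp
  have h2 : MDifferentiableAt (𝓡 (n + 1)) (endModel n) Φ.symm (Φ p) :=
    Φ.symm.mdifferentiableAt (by simp) (Φ.map_source hp)
  have h3 : Φ.symm ∘ Φ =ᶠ[𝓝 p] id := by
    filter_upwards [Φ.open_source.mem_nhds hp] with x hx
    exact Φ.left_inv hx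
  let D : EuclideanSpace ℝ (Fin n) × ℝ →L[ℝ] EuclideanSpace ℝ (Fin (n + 1)) :=
    mfderiv (endModel n) (𝓡 (n + 1)) Φ p
  have hinj : Function.Injective D := by
    refine Function.LeftInverse.injective
      (g := mfderiv (𝓡 (n + 1)) (endModel n) Φ.symm (Φ p)) fun w => ?_
    have h4 := mfderiv_comp_apply p h2 h1 w
    rw [h3.mfderiv_eq, mfderiv_id] at h4
    exact h4.symm
  exact (LinearMap.injective_iff_surjective_of_finrank_eq_finrank (f := D.toLinearMap)
    (by simp)).1 hinj v

theorem IsGoodCenter.mem_source (h : IsGoodCenter θ K T v₀ r₀) (hΦ : Φ.source = univ ×ˢ Ioi 1)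
    {z : EuclideanSpace ℝ (Fin n) × ℝ} (hz : sqNorm z < (2 * T) ^ 2) :
    endParam φ v₀ (θ r₀) r₀ z ∈ Φ.source := by
  rw [hΦ]
  exact ⟨mem_univ _, h.one_lt z hz⟩

/-- The straight segment from `0` to `z` in rescaled coordinates is a competitor for the distance.
-/
theorem IsGoodCenter.edist_le (h : IsGoodCenter θ K T v₀ r₀)
    (hφ : φ ∈ IsManifold.maximalAtlas (𝓡 n) ∞ N) (hK : K ⊆ φ.target) {κ : ℝ} (hκ1 : 1 ≤ κ)
    (hκ : ∀ v ∈ K, ∀ w, ‖w‖ ^ 2 ≤ κ * chartForm φ v w w ∧ chartForm φ v w w ≤ κ * ‖w‖ ^ 2)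
    (hΦ : Φ.source = univ ×ˢ Ioi 1) {C : ℝ} (hC0 : 0 ≤ C)
    (hC : ∀ p ∈ Φ.source, ∀ v : TangentSpace (endModel n) p,
      ‖mfderiv (endModel n) (𝓡 (n + 1)) Φ p v‖ ^ 2 ≤ C * warpedMetric n θ p v v)
    {z : EuclideanSpace ℝ (Fin n) × ℝ} (hz : sqNorm z < (2 * T) ^ 2) :
    edist (Φ (endParam φ v₀ (θ r₀) r₀ 0)) (Φ (endParam φ v₀ (θ r₀) r₀ z)) ≤
      ENNReal.ofReal (Real.sqrt (C * (4 * κ * sqNorm z))) := by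
  have hzt : ∀ t ∈ Icc (0 : ℝ) 1, sqNorm (t • z) < (2 * T) ^ 2 := fun t ht => by
    rw [sqNorm_smul]
    refine lt_of_le_of_lt (mul_le_of_le_one_left (sqNorm_nonneg z) ?_) hz
    exact pow_le_one₀ ht.1 ht.2
  set g : EuclideanSpace ℝ (Fin n) × ℝ → M := fun w => Φ (endParam φ v₀ (θ r₀) r₀ w) with hg
  have hgs : ∀ t ∈ Icc (0 : ℝ) 1,
      ContMDiffAt 𝓘(ℝ, EuclideanSpace ℝ (Fin n) × ℝ) (𝓡 (n + 1)) ∞ g (t • z) := fun t ht => by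
    have h1 := contMDiffAt_endParam (r₀ := r₀) hφ (hK (h.mem _ (hzt t ht)))
    have h2 := Φ.contMDiffOn.contMDiffAt
      (Φ.open_source.mem_nhds (h.mem_source (φ := φ) hΦ (hzt t ht)))
    exact h2.comp _ h1
  have hl : ContMDiff 𝓘(ℝ, ℝ) 𝓘(ℝ, EuclideanSpace ℝ (Fin n) × ℝ) ∞ fun t : ℝ => t • z := by
    rw [contMDiff_iff_contDiff]; fun_prop
  have key := edist_le_of_norm_mfderiv_le (I := 𝓡 (n + 1)) (γ := fun t : ℝ => g (t • z))
    (C := Real.sqrt (C * (4 * κ * sqNorm z)))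
    (fun t ht => (((hgs t ht).comp t (hl t)).of_le (by simp)).contMDiffWithinAt) fun t ht => ?_
  · simpa [hg] using key
  · have ht' := Ioo_subset_Icc_self ht
    have h1 := (contMDiffAt_endParam (r₀ := r₀) hφ
      (hK (h.mem _ (hzt t ht')))).mdifferentiableAt (by simp)
    have h2 : MDifferentiableAt (endModel n) (𝓡 (n + 1)) Φ (endParam φ v₀ (θ r₀) r₀ (t • z)) :=
      Φ.mdifferentiableAt (by simp) (h.mem_source hΦ (hzt t ht'))
    have h3 := mfderiv_comp_apply t ((hgs t ht').mdifferentiableAt (by simp))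
      ((hl t).mdifferentiableAt (by simp)) (1 : ℝ)
    have h4 : mfderiv 𝓘(ℝ, ℝ) 𝓘(ℝ, EuclideanSpace ℝ (Fin n) × ℝ) (fun t : ℝ => t • z) t (1 : ℝ)
        = z := by
      rw [mfderiv_eq_fderiv]
      have : HasDerivAt (fun t : ℝ => t • z) z t := by simpa using (hasDerivAt_id t).smul_const z
      erw [this.hasFDerivAt.fderiv]
      exact one_smul ℝ z
    have h5 := mfderiv_comp_apply (t • z) h2 h1 z
    have h6 : mfderiv 𝓘(ℝ, ℝ) (𝓡 (n + 1)) (fun t : ℝ => g (t • z)) t (1 : ℝ) =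
        mfderiv (endModel n) (𝓡 (n + 1)) Φ (endParam φ v₀ (θ r₀) r₀ (t • z))
          (mfderiv 𝓘(ℝ, EuclideanSpace ℝ (Fin n) × ℝ) (endModel n)
            (endParam φ v₀ (θ r₀) r₀) (t • z) z) := by
      refine h3.trans (Eq.trans ?_ h5)
      exact congrArg _ h4
    rw [h6]
    refine Real.le_sqrt_of_sq_le ((hC _ (h.mem_source hΦ (hzt t ht')) _).trans ?_)
    exact mul_le_mul_of_nonneg_left (h.metric_bounds hφ hK hκ1 hκ (hzt t ht') z).2 hC0

/-- A short curve in `M` might leave the chart or the end. Instead of following it, extend the bump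
by zero to a function on `M`: it is `3` at the center and Lipschitz with constant `B / T * √(4κ/c)`,
so by `hD` it is still positive at `q`, and `q` lies in the ball. -/
theorem IsGoodCenter.exists_of_edist_lt (h : IsGoodCenter θ K T v₀ r₀) (hT : 0 < T)
    (hφ : φ ∈ IsManifold.maximalAtlas (𝓡 n) ∞ N) (hK : K ⊆ φ.target)
    {κ : ℝ} (hκ1 : 1 ≤ κ)
    (hκ : ∀ v ∈ K, ∀ w, ‖w‖ ^ 2 ≤ κ * chartForm φ v w w ∧ chartForm φ v w w ≤ κ * ‖w‖ ^ 2)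
    (hΦ : Φ.source = univ ×ˢ Ioi 1) {c : ℝ} (hc0 : 0 < c)
    (hc : ∀ p ∈ Φ.source, ∀ v : TangentSpace (endModel n) p,
      c * warpedMetric n θ p v v ≤ ‖mfderiv (endModel n) (𝓡 (n + 1)) Φ p v‖ ^ 2)
    {B : ℝ} (hB0 : 0 < B) (hB : ∀ T : ℝ, 0 < T → ∀ z w : EuclideanSpace ℝ (Fin n) × ℝ,
      |fderiv ℝ (radialBump T) z w| ≤ B / T * Real.sqrt (sqNorm w))
    {D : ℝ} (hD0 : 0 < D) (hD : B / T * Real.sqrt (4 * κ / c) * D < 3) {q : M}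
    (hq : edist (Φ (endParam φ v₀ (θ r₀) r₀ 0)) q < ENNReal.ofReal D) :
    ∃ z, sqNorm z < T ^ 2 ∧ q = Φ (endParam φ v₀ (θ r₀) r₀ z) := by
  classical
  set S := endParam φ v₀ (θ r₀) r₀ with hS
  set X := endCoord φ v₀ (θ r₀) r₀ with hX
  have hle : ∀ z : EuclideanSpace ℝ (Fin n) × ℝ, sqNorm z ≤ T ^ 2 → sqNorm z < (2 * T) ^ 2 :=
    fun z hz => by nlinarith
  set O : Set (N × ℝ) := Φ.source ∩ Prod.fst ⁻¹' φ.source with hO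
  have hOo : IsOpen O := Φ.open_source.inter (φ.open_source.preimage continuous_fst)
  set O' : Set M := Φ.target ∩ Φ.symm ⁻¹' O with hO'
  have hO'o : IsOpen O' :=
    Φ.symm.contMDiffOn.continuousOn.isOpen_inter_preimage Φ.open_target hOo
  set F : M → ℝ := fun m => if m ∈ O' then radialBump T (X (Φ.symm m)) else 0 with hF
  have hSz : ∀ z : EuclideanSpace ℝ (Fin n) × ℝ, sqNorm z < (2 * T) ^ 2 →
      S z ∈ O ∧ X (S z) = z := fun z hz =>
    ⟨⟨h.mem_source hΦ hz, φ.map_target (hK (h.mem z hz))⟩,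
      endCoord_endParam h.ne_zero (hK (h.mem z hz))⟩
  have hΦS : ∀ z : EuclideanSpace ℝ (Fin n) × ℝ, sqNorm z < (2 * T) ^ 2 →
      Φ (S z) ∈ O' ∧ Φ.symm (Φ (S z)) = S z := fun z hz => by
    have h1 : Φ.symm (Φ (S z)) = S z := Φ.left_inv (hSz z hz).1.1
    exact ⟨⟨Φ.map_source (hSz z hz).1.1, by rw [mem_preimage, h1]; exact (hSz z hz).1⟩, h1⟩
  have hFS : ∀ z : EuclideanSpace ℝ (Fin n) × ℝ, sqNorm z < (2 * T) ^ 2 →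
      F (Φ (S z)) = radialBump T z := fun z hz => by
    simp only [hF, if_pos (hΦS z hz).1, (hΦS z hz).2, (hSz z hz).2]
  have hform : ∀ m ∈ O', sqNorm (X (Φ.symm m)) < (2 * T) ^ 2 →
      m = Φ (S (X (Φ.symm m))) := fun m hm hz => by
    rw [hS, hX, endParam_endCoord h.ne_zero hm.2.2]
    exact (Φ.right_inv hm.1).symm
  -- This image is compact, hence closed in the Hausdorff space `M`; this is what makes the
  -- extension of the bump by zero smooth.
  set Q : Set M := (fun z => Φ (S z)) '' {z | sqNorm z ≤ T ^ 2} with hQ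
  have hQc : IsClosed Q := by
    refine IsCompact.isClosed (IsCompact.image_of_continuousOn ?_ fun z hz => ?_)
    · refine (isCompact_closedBall (0 : EuclideanSpace ℝ (Fin n) × ℝ) T).of_isClosed_subset
        (isClosed_le contDiff_sqNorm.continuous continuous_const) fun z hz => ?_
      have := (norm_sq_le_sqNorm z).trans hz
      rw [mem_closedBall_zero_iff]
      exact abs_le_of_sq_le_sq' this hT.le |>.2
    · have h1 := (contMDiffAt_endParam (r₀ := r₀) hφ (hK (h.mem z (hle z hz)))).continuousAt
      have h2 := (Φ.contMDiffOn.contMDiffAt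
        (Φ.open_source.mem_nhds (hSz z (hle z hz)).1.1)).continuousAt
      exact (ContinuousAt.comp (f := S) h2 h1).continuousWithinAt
  have hFQ : ∀ m ∉ Q, F m = 0 := fun m hm => by
    by_cases hmO : m ∈ O'
    · simp only [hF, if_pos hmO]
      refine radialBump_eq_zero hT ?_
      by_contra! hlt
      exact hm ⟨_, hlt.le, (hform m hmO (hle _ hlt.le)).symm⟩
    · simp only [hF, if_neg hmO]
  have hFQ' : ∀ m ∉ Q, F =ᶠ[𝓝 m] fun _ => 0 := fun m hm =>
    eventually_of_mem (hQc.isOpen_compl.mem_nhds hm) hFQ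
  have hQO : ∀ m ∈ Q, m ∈ O' := by
    rintro m ⟨z, hz, rfl⟩
    exact (hΦS z (hle z hz)).1
  have hFO : ∀ m ∈ O', F =ᶠ[𝓝 m] fun m => radialBump T (X (Φ.symm m)) := fun m hm =>
    eventually_of_mem (hO'o.mem_nhds hm) fun m hm => by simp only [hF, if_pos hm]
  have hFs : ContMDiff (𝓡 (n + 1)) 𝓘(ℝ, ℝ) ∞ F := fun m => by
    by_cases hm : m ∈ Q
    · refine ContMDiffAt.congr_of_eventuallyEq ?_ (hFO m (hQO m hm))
      have h1 := Φ.symm.contMDiffOn.contMDiffAt (Φ.open_target.mem_nhds (hQO m hm).1)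
      have h2 : ContMDiffAt (endModel n) 𝓘(ℝ, EuclideanSpace ℝ (Fin n) × ℝ) ∞ X (Φ.symm m) :=
        contMDiffAt_endCoord hφ (hQO m hm).2.2
      exact ((contDiff_radialBump T).contMDiff _).comp m (h2.comp m h1)
    · exact contMDiffAt_const.congr_of_eventuallyEq (hFQ' m hm)
  set B' : ℝ := B / T * Real.sqrt (4 * κ / c) with hB'
  have hB'0 : 0 ≤ B' := by positivity
  have hder : ∀ m (v : TangentSpace (𝓡 (n + 1)) m),
      |(show ℝ from mfderiv (𝓡 (n + 1)) 𝓘(ℝ, ℝ) F m v)| ≤ B'.toNNReal * ‖v‖ := fun m v => by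
    rw [Real.coe_toNNReal _ hB'0]
    by_cases hm : m ∈ Q
    · obtain ⟨z, hz, rfl⟩ := hm
      have hz' := hle z hz
      obtain ⟨u, rfl⟩ := mfderiv_partialDiffeomorph_surjective (hSz z hz').1.1 v
      have h1 : MDifferentiableAt (endModel n) (𝓡 (n + 1)) Φ (S z) :=
        Φ.mdifferentiableAt (by simp) (hSz z hz').1.1
      have h2 := mfderiv_comp_apply (S z) ((hFs (Φ (S z))).mdifferentiableAt (by simp)) h1 u
      have h3 : F ∘ Φ =ᶠ[𝓝 (S z)] radialBump T ∘ X := by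
        filter_upwards [hOo.mem_nhds (hSz z hz').1] with p hp
        have h4 : Φ.symm (Φ p) = p := Φ.left_inv hp.1
        have h5 : Φ p ∈ O' := ⟨Φ.map_source hp.1, by rw [mem_preimage, h4]; exact hp⟩
        simp only [Function.comp_apply, hF, if_pos h5, h4]
      have h6 := h.abs_mfderiv_le hT hφ hK hκ1 hκ hB0 hB hz' h3 u
      have h7 := hc _ (hSz z hz').1.1 u
      have h8 : ∀ {x y c : ℝ}, x = y → |x| ≤ c → |y| ≤ c := fun hxy h => by rwa [← hxy]
      refine h8 h2 (h6.trans ?_)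
      rw [hB', mul_assoc (B / T)]
      refine mul_le_mul_of_nonneg_left ?_ (div_pos hB0 hT).le
      refine Real.sqrt_le_iff.2 ⟨mul_nonneg (Real.sqrt_nonneg _) (norm_nonneg _), ?_⟩
      rw [mul_pow, Real.sq_sqrt (by positivity), div_mul_eq_mul_div, le_div_iff₀ hc0]
      calc _ = 4 * κ * (c * warpedMetric n θ (S z) u u) := by ring
        _ ≤ _ := by gcongr
    · have h8 : ∀ {x c : ℝ}, x = (0 : ℝ) → 0 ≤ c → |x| ≤ c := fun hx h => by simpa [hx] using h
      refine h8 ?_ (by positivity)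
      exact DFunLike.congr_fun ((hFQ' m hm).mfderiv_eq.trans mfderiv_const) v
  have hlip := edist_le_mul_of_abs_mfderiv_le (hFs.of_le (by simp)) hder hq
  have hF0 : F (Φ (S 0)) = 3 := by
    rw [hFS 0 (by simp only [sqNorm]; simp; positivity), radialBump_zero]
  have hFq : 0 < F q := by
    by_contra! hle0
    have h1 : (3 : ℝ) ≤ dist (F (Φ (S 0))) (F q) := by
      rw [hF0, Real.dist_eq]
      exact le_trans (by linarith) (le_abs_self _)
    have h2 : dist (F (Φ (S 0))) (F q) ≤ B' * D := by
      rw [edist_dist, ← ENNReal.ofReal_coe_nnreal, ← ENNReal.ofReal_mul (by positivity),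
        Real.coe_toNNReal _ hB'0] at hlip
      exact (ENNReal.ofReal_le_ofReal_iff (by positivity)).1 hlip
    linarith
  have hqO : q ∈ O' := by
    by_contra hqO
    simp only [hF, if_neg hqO, lt_irrefl] at hFq
  simp only [hF, if_pos hqO] at hFq
  have hlt := sqNorm_lt_of_radialBump_pos hT hFq
  exact ⟨_, hlt, hform q hqO (hle _ hlt.le)⟩

end EndDistance

/-! ### Sums of bumps with disjoint supports. -/

section Cluster

variable {n : ℕ} {N : Type*} [TopologicalSpace N] [T2Space N]
  [ChartedSpace (EuclideanSpace ℝ (Fin n)) N] [IsManifold (𝓡 n) ∞ N]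
  {φ : OpenPartialHomeomorph N (EuclideanSpace ℝ (Fin n))}
  {θ : ℝ → ℝ} {K : Set (EuclideanSpace ℝ (Fin n))} {T R : ℝ}
  {C : Set (EuclideanSpace ℝ (Fin n) × ℝ)}

theorem sqNorm_add_le {V : Type*} [NormedAddCommGroup V] [InnerProductSpace ℝ V] (z w : V × ℝ) :
    sqNorm (z + w) ≤ 2 * sqNorm z + 2 * sqNorm w := by
  have h := norm_add_le z.1 w.1
  simp only [sqNorm, Prod.fst_add, Prod.snd_add]
  nlinarith [sq_nonneg (‖z.1‖ - ‖w.1‖), sq_nonneg (z.2 - w.2), norm_nonneg (z.1 + w.1),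
    norm_nonneg z.1, norm_nonneg w.1]

/-- The points at rescaled distance less than `T` from the center `c`. -/
def endBall (φ : OpenPartialHomeomorph N (EuclideanSpace ℝ (Fin n))) (θ : ℝ → ℝ) (T : ℝ)
    (c : EuclideanSpace ℝ (Fin n) × ℝ) : Set (N × ℝ) :=
  {p | p.1 ∈ φ.source ∧ sqNorm (endCoord φ c.1 (θ c.2) c.2 p) < T ^ 2}

theorem endBall_mono {S : ℝ} (hS : 0 ≤ S) (hST : S ≤ T) (c : EuclideanSpace ℝ (Fin n) × ℝ) :
    endBall φ θ S c ⊆ endBall φ θ T c := fun _ hp =>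
  ⟨hp.1, hp.2.trans_le (pow_le_pow_left₀ hS hST 2)⟩

theorem isOpen_endBall (c : EuclideanSpace ℝ (Fin n) × ℝ) : IsOpen (endBall φ θ T c) := by
  have h : ContinuousOn (fun p : N × ℝ => sqNorm (endCoord φ c.1 (θ c.2) c.2 p))
      (Prod.fst ⁻¹' φ.source) := by
    refine contDiff_sqNorm.continuous.comp_continuousOn ?_
    have h1 : ContinuousOn (fun p : N × ℝ => φ p.1) (Prod.fst ⁻¹' φ.source) :=
      φ.continuousOn.comp continuousOn_fst fun p hp => hp
    exact ((h1.sub continuousOn_const).const_smul (θ c.2)).prodMk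
      (continuousOn_snd.sub continuousOn_const)
  exact h.isOpen_inter_preimage (φ.open_source.preimage continuous_fst) isOpen_Iio

open Classical in
/-- The sum of the bumps of radius `T` about the centers in `C`, provided these have disjoint
supports. -/
def clusterFun (φ : OpenPartialHomeomorph N (EuclideanSpace ℝ (Fin n))) (θ : ℝ → ℝ) (T : ℝ)
    (C : Set (EuclideanSpace ℝ (Fin n) × ℝ)) (p : N × ℝ) : ℝ :=
  if h : ∃ c ∈ C, p ∈ endBall φ θ T c then
    radialBump T (endCoord φ h.choose.1 (θ h.choose.2) h.choose.2 p)
  else 0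

theorem clusterFun_nonneg (p : N × ℝ) : 0 ≤ clusterFun φ θ T C p := by
  unfold clusterFun
  split_ifs with h
  · exact radialBump_nonneg _ _
  · exact le_rfl

theorem clusterFun_le (hT : 0 < T) (p : N × ℝ) : clusterFun φ θ T C p ≤ 3 := by
  unfold clusterFun
  split_ifs with h
  · exact radialBump_le hT _
  · norm_num

/-- Disjointness is required at radius `2T` although the supports have radius `T`, so that near
every point of a `2T`-ball the function is a single bump, also across the boundary of its support.
-/
theorem clusterFun_eventuallyEq (hT : 0 < T)
    (hdisj : ∀ c ∈ C, ∀ c' ∈ C, ∀ p ∈ endBall φ θ (2 * T) c, p ∈ endBall φ θ (2 * T) c' → c = c')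
    {c : EuclideanSpace ℝ (Fin n) × ℝ} (hc : c ∈ C) {p : N × ℝ} (hp : p ∈ endBall φ θ (2 * T) c) :
    clusterFun φ θ T C =ᶠ[𝓝 p] radialBump T ∘ endCoord φ c.1 (θ c.2) c.2 := by
  filter_upwards [(isOpen_endBall c).mem_nhds hp] with q hq
  unfold clusterFun
  split_ifs with h
  · have h1 := h.choose_spec
    rw [← hdisj c hc _ h1.1 q hq (endBall_mono hT.le (by linarith) _ h1.2)]
    rfl
  · refine (radialBump_eq_zero hT ?_).symm
    by_contra! hlt
    exact h ⟨c, hc, hq.1, hlt⟩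

/-- There may be infinitely many centers, so the neighborhood must serve all of them. If `q` near
`p` lay in the `T`-ball of a center, the scale of that center would be at most `2 * θ q.2`, hence
bounded, and `p` would lie in its `2T`-ball. Off the compact set over `K` no ball is met at all. -/
theorem clusterFun_eventuallyEq_zero (hθ : IsSubconicScaling θ) (hT : 0 < T) (hKc : IsCompact K)
    (hK : K ⊆ φ.target) (hC : ∀ c ∈ C, IsGoodCenter θ K T c.1 c.2) {p : N × ℝ} (hp1 : 1 < p.2)
    (hp : ∀ c ∈ C, p ∉ endBall φ θ (2 * T) c) : clusterFun φ θ T C =ᶠ[𝓝 p] fun _ => 0 := by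
  have hT2 : T ^ 2 ≤ (2 * T) ^ 2 := by nlinarith
  suffices h : ∀ᶠ q in 𝓝 p, ∀ c ∈ C, q ∉ endBall φ θ T c by
    filter_upwards [h] with q hq
    rw [clusterFun, dif_neg]
    rintro ⟨c, hc, hqc⟩
    exact hq c hc hqc
  have hKs : IsClosed (φ.symm '' K) := (hKc.image_of_continuousOn (φ.continuousOn_symm.mono hK)).isClosed
  by_cases hpK : p.1 ∈ φ.symm '' K
  · have hps : p.1 ∈ φ.source := by
      obtain ⟨v, hv, hvp⟩ := hpK
      rw [← hvp]; exact φ.map_target (hK hv)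
    have h1 : ContinuousAt (fun q : N × ℝ => 2 * (θ p.2 + 1) * ‖φ q.1 - φ p.1‖) p := by
      have h2 : ContinuousAt (fun q : N × ℝ => φ q.1) p :=
        ContinuousAt.comp (f := Prod.fst) (φ.continuousAt hps) continuousAt_fst
      exact continuousAt_const.mul (h2.sub continuousAt_const).norm
    have e1 : ∀ᶠ q in 𝓝 p, 2 * (θ p.2 + 1) * ‖φ q.1 - φ p.1‖ < T / 2 :=
      h1.eventually_lt_const (by simpa using hT)
    have e2 : ∀ᶠ q in 𝓝 p, |q.2 - p.2| < T / 2 := by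
      have h2 : ContinuousAt (fun q : N × ℝ => |q.2 - p.2|) p := by fun_prop
      exact h2.eventually_lt_const (by simpa using hT)
    have e3 : ∀ᶠ q in 𝓝 p, θ q.2 < θ p.2 + 1 := by
      have h2 : ContinuousAt (fun q : N × ℝ => θ q.2) p :=
        ContinuousAt.comp (f := Prod.snd) (hθ.contDiffAt hp1).continuousAt continuousAt_snd
      exact h2.eventually_lt_const (by simp)
    filter_upwards [e1, e2, e3] with q h1 h2 h3 c hc hq
    refine hp c hc ⟨hps, ?_⟩
    have hgood := hC c hc
    have h4 := (hgood.le_two_mul _ (hq.2.trans_le hT2)).2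
    have h5 : (endCoord φ c.1 (θ c.2) c.2 q).2 + c.2 = q.2 := by simp [endCoord]
    rw [h5] at h4
    have h6 : endCoord φ c.1 (θ c.2) c.2 p = endCoord φ c.1 (θ c.2) c.2 q +
        (θ c.2 • (φ p.1 - φ q.1), p.2 - q.2) := by
      simp only [endCoord, Prod.mk_add_mk, ← smul_add]
      refine Prod.ext ?_ ?_
      · simp
      · simp
    have hσ : 0 ≤ θ c.2 := zero_le_one.trans hgood.one_le
    have h7 : ‖θ c.2 • (φ p.1 - φ q.1)‖ ≤ T / 2 := by
      rw [norm_smul, Real.norm_eq_abs, abs_of_nonneg hσ, norm_sub_rev]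
      refine le_trans (mul_le_mul_of_nonneg_right ?_ (norm_nonneg _)) h1.le
      linarith
    have h8 : sqNorm (θ c.2 • (φ p.1 - φ q.1), p.2 - q.2) ≤ T ^ 2 / 2 := by
      simp only [sqNorm]
      have h9 : (p.2 - q.2) ^ 2 ≤ (T / 2) ^ 2 := by
        rw [← sq_abs, abs_sub_comm]
        exact pow_le_pow_left₀ (abs_nonneg _) h2.le 2
      have h10 := pow_le_pow_left₀ (norm_nonneg _) h7 2
      linarith [h9, h10, div_pow T 2 2]
    rw [h6]
    -- The bound is `2 T² + 2 (T² / 2) = 3 T²`, less than `(2 T)²`.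
    refine (sqNorm_add_le _ _).trans_lt ?_
    nlinarith [hq.2]
  · have hV : ∀ᶠ q in 𝓝 p, q.1 ∈ (φ.symm '' K)ᶜ :=
      continuousAt_fst.eventually (hKs.isOpen_compl.mem_nhds hpK)
    filter_upwards [hV] with q hq c hc hqc
    have hgood := hC c hc
    have h1 := hgood.mem _ (hqc.2.trans_le hT2)
    rw [endCoord_fst_mem hgood.ne_zero] at h1
    exact hq ⟨φ q.1, h1, φ.left_inv hqc.1⟩

theorem exists_mem_endBall_of_clusterFun_pos {p : N × ℝ}
    (hp : 0 < clusterFun φ θ T C p) : ∃ c ∈ C, p ∈ endBall φ θ T c := by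
  by_contra h
  rw [clusterFun, dif_neg h] at hp
  exact lt_irrefl _ hp

variable [RiemannianBundle (fun y : N => TangentSpace (𝓡 n) y)]
  [IsContMDiffRiemannianBundle (𝓡 n) ∞ (EuclideanSpace ℝ (Fin n))
      (fun y : N => TangentSpace (𝓡 n) y)]

theorem isCbInfty_clusterFun (hθ : IsSubconicScaling θ) (hT : 0 < T)
    (hφ : φ ∈ IsManifold.maximalAtlas (𝓡 n) ∞ N) (hKc : IsCompact K)
    (hK : K ⊆ φ.target) (hC : ∀ c ∈ C, IsGoodCenter θ K T c.1 c.2)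
    (hdisj : ∀ c ∈ C, ∀ c' ∈ C, ∀ p ∈ endBall φ θ (2 * T) c, p ∈ endBall φ θ (2 * T) c' → c = c')
    (hR : 1 ≤ R) :
    IsCbInfty (warpedMetric n θ) (endBasis n) (univ ×ˢ Ioi R) (clusterFun φ θ T C) := by
  have hlt : ∀ p ∈ (univ : Set N) ×ˢ Ioi R, 1 < p.2 := fun p hp => hR.trans_lt hp.2
  refine ⟨fun p hp => ContMDiffAt.contMDiffWithinAt ?_, fun j => ?_⟩
  · by_cases h : ∃ c ∈ C, p ∈ endBall φ θ (2 * T) c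
    · obtain ⟨c, hc, hpc⟩ := h
      refine ContMDiffAt.congr_of_eventuallyEq ?_ (clusterFun_eventuallyEq hT hdisj hc hpc)
      exact ((contDiff_radialBump T).contMDiff _).comp p (contMDiffAt_endCoord hφ hpc.1)
    · push Not at h
      exact contMDiffAt_const.congr_of_eventuallyEq
        (clusterFun_eventuallyEq_zero hθ hT hKc hK hC (hlt p hp) h)
  · obtain ⟨D, hD⟩ := exists_covNorm_radialBump_le hθ hT hφ hKc hK j
    refine ⟨max D 0, fun p hp => ?_⟩
    by_cases h : ∃ c ∈ C, p ∈ endBall φ θ (2 * T) c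
    · obtain ⟨c, hc, hpc⟩ := h
      obtain ⟨e, he, hpe, hle⟩ := hD c.1 c.2 (hC c hc) p hpc.1 hpc.2 _
        (clusterFun_eventuallyEq hT hdisj hc hpc)
      exact ⟨e, he, hpe, hle.trans (le_max_left _ _)⟩
    · push Not at h
      have h0 := clusterFun_eventuallyEq_zero hθ hT hKc hK hC (hlt p hp) h
      refine ⟨chartAt _ p, IsManifold.chart_mem_maximalAtlas p, mem_chart_source _ p, ?_⟩
      rw [covNorm_eq_zero]
      · exact le_max_right _ _
      · have hc := (chartAt (ModelProd (EuclideanSpace ℝ (Fin n)) ℝ) p).continuousAt_extend_symm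
          (I := endModel n) (mem_chart_source _ p)
        unfold ContinuousAt at hc
        rw [OpenPartialHomeomorph.extend_left_inv _ (mem_chart_source _ p)] at hc
        exact hc.eventually h0

end Cluster

/-! ### Grid cells and residue classes. -/

section Cells

variable {n : ℕ} {θ : ℝ → ℝ}

/-- The cell of a grid of mesh `1` with respect to the metric `dr² + θ² |dv|²`. -/
def cellIndex (θ : ℝ → ℝ) (c : EuclideanSpace ℝ (Fin n) × ℝ) : ℤ × (Fin n → ℤ) :=
  (⌊c.2⌋, fun a => ⌊θ ⌊c.2⌋ * c.1 a⌋)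

/-- The residues modulo `q` of the indices of a cell. -/
def cellClass (q : ℕ) (k : ℤ × (Fin n → ℤ)) : ZMod q × (Fin n → ZMod q) :=
  ((k.1 : ZMod q), fun a => (k.2 a : ZMod q))

/-- The floors differ by less than `D + 1 ≤ q`, and their difference is divisible by `q`. -/
theorem floor_eq_floor_of_cast_eq {q : ℕ} {x y D : ℝ} (hxy : |x - y| ≤ D) (hD : D + 1 ≤ q)
    (h : ((⌊x⌋ : ℤ) : ZMod q) = (⌊y⌋ : ℤ)) : ⌊x⌋ = ⌊y⌋ := by
  rw [ZMod.intCast_eq_intCast_iff, Int.modEq_iff_dvd] at h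
  have h1 : |((⌊y⌋ - ⌊x⌋ : ℤ) : ℝ)| < q := by
    push_cast
    have := abs_le.1 hxy
    rw [abs_lt]
    constructor <;> linarith [Int.floor_le x, Int.floor_le y, Int.lt_floor_add_one x,
      Int.lt_floor_add_one y]
  have h2 : |⌊y⌋ - ⌊x⌋| < (q : ℤ) := by exact_mod_cast h1
  have := Int.eq_zero_of_abs_lt_dvd h h2
  omega

theorem norm_le_of_forall_abs_le {v : EuclideanSpace ℝ (Fin n)} {D : ℝ}
    (h : ∀ a, |v a| ≤ D) : ‖v‖ ≤ n * D := by
  have hv : v = ∑ a, v a • EuclideanSpace.single a (1 : ℝ) := by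
    have := (EuclideanSpace.basisFun (Fin n) ℝ).sum_repr v
    simpa using this.symm
  rw [hv]
  refine (norm_sum_le _ _).trans ?_
  refine (Finset.sum_le_card_nsmul Finset.univ _ D fun a _ => ?_).trans (by simp)
  rw [norm_smul]
  simpa using h a

theorem norm_le_of_cellIndex_eq {c c' : EuclideanSpace ℝ (Fin n) × ℝ}
    (h : cellIndex θ c = cellIndex θ c') (hθ : 0 ≤ θ ⌊c.2⌋) :
    |c.2 - c'.2| ≤ 1 ∧ θ ⌊c.2⌋ * ‖c.1 - c'.1‖ ≤ n := by
  simp only [cellIndex, Prod.mk.injEq] at h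
  obtain ⟨h1, h2⟩ := h
  refine ⟨(Int.abs_sub_lt_one_of_floor_eq_floor h1).le, ?_⟩
  have h3 : ‖θ ⌊c.2⌋ • (c.1 - c'.1)‖ ≤ n * 1 := norm_le_of_forall_abs_le fun a => by
    have h4 := congrFun h2 a
    rw [← h1] at h4
    have h5 := (Int.abs_sub_lt_one_of_floor_eq_floor h4).le
    rw [← mul_sub] at h5
    simpa using h5
  rwa [norm_smul, Real.norm_eq_abs, abs_of_nonneg hθ, mul_one] at h3

end Cells

/-! ### Separation within a residue class, and density of the kept centers. -/

section Net

variable {n : ℕ} {N : Type*} [TopologicalSpace N] [T2Space N]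
  [ChartedSpace (EuclideanSpace ℝ (Fin n)) N] [IsManifold (𝓡 n) ∞ N]
  {φ : OpenPartialHomeomorph N (EuclideanSpace ℝ (Fin n))}
  {θ : ℝ → ℝ} {K : Set (EuclideanSpace ℝ (Fin n))} {T : ℝ}

theorem abs_snd_lt_of_sqNorm_lt {V : Type*} [NormedAddCommGroup V] [InnerProductSpace ℝ V]
    {z : V × ℝ} {D : ℝ} (hD : 0 ≤ D) (hz : sqNorm z < D ^ 2) : |z.2| < D := by
  refine abs_lt_of_sq_lt_sq ?_ hD
  unfold sqNorm at hz
  nlinarith [sq_nonneg ‖z.1‖]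

theorem norm_fst_lt_of_sqNorm_lt {V : Type*} [NormedAddCommGroup V] [InnerProductSpace ℝ V]
    {z : V × ℝ} {D : ℝ} (hD : 0 ≤ D) (hz : sqNorm z < D ^ 2) : ‖z.1‖ < D := by
  refine lt_of_pow_lt_pow_left₀ 2 hD ?_
  unfold sqNorm at hz
  nlinarith [sq_nonneg z.2]

theorem IsGoodCenter.of_abs_lt {v₀ : EuclideanSpace ℝ (Fin n)} {r₀ r : ℝ}
    (h : IsGoodCenter θ K T v₀ r₀) (hr : |r - r₀| < 2 * T) :
    1 < r ∧ θ r ≤ 2 * θ r₀ ∧ θ r₀ ≤ 2 * θ r := by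
  have hz : sqNorm ((0, r - r₀) : EuclideanSpace ℝ (Fin n) × ℝ) < (2 * T) ^ 2 := by
    simp only [sqNorm, norm_zero, ne_eq, OfNat.ofNat_ne_zero, not_false_eq_true, zero_pow, zero_add]
    rw [← sq_abs]
    exact pow_lt_pow_left₀ hr (abs_nonneg _) two_ne_zero
  have h1 := h.one_lt _ hz
  have h2 := h.le_two_mul _ hz
  simp only [sub_add_cancel] at h1 h2
  exact ⟨h1, h2⟩

theorem IsGoodCenter.floor {v₀ : EuclideanSpace ℝ (Fin n)} {r₀ : ℝ}
    (h : IsGoodCenter θ K T v₀ r₀) (hT : 1 ≤ T) :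
    1 < (⌊r₀⌋ : ℝ) ∧ θ ⌊r₀⌋ ≤ 2 * θ r₀ ∧ θ r₀ ≤ 2 * θ ⌊r₀⌋ := by
  refine h.of_abs_lt ?_
  rw [abs_lt]
  constructor <;> linarith [Int.floor_le r₀, Int.lt_floor_add_one r₀]

/-- Centers whose `2T`-balls meet have heights less than `4T` apart. In the directions of `N`, each
is within `2T` of `p` at its own scale, hence within `4T` at the common scale of the cell row, so
their grid coordinates differ by at most `8T`. Congruent indices are then equal. -/
theorem cellIndex_eq_of_mem_endBall (hθ : IsSubconicScaling θ) (hT : 1 ≤ T)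
    {c c' : EuclideanSpace ℝ (Fin n) × ℝ} (hc : IsGoodCenter θ K T c.1 c.2)
    (hc' : IsGoodCenter θ K T c'.1 c'.2) {p : N × ℝ} (hp : p ∈ endBall φ θ (2 * T) c)
    (hp' : p ∈ endBall φ θ (2 * T) c') {q : ℕ} (hq : 8 * T + 1 ≤ q)
    (h : cellClass q (cellIndex θ c) = cellClass q (cellIndex θ c')) :
    cellIndex θ c = cellIndex θ c' := by
  simp only [cellClass, cellIndex, Prod.mk.injEq] at h ⊢
  obtain ⟨h1, h2⟩ := h
  have hT0 : 0 ≤ 2 * T := by linarith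
  have hfloor : ⌊c.2⌋ = ⌊c'.2⌋ := by
    refine floor_eq_floor_of_cast_eq (D := 4 * T) ?_ (by linarith) h1
    have e1 : |p.2 - c.2| < 2 * T := abs_snd_lt_of_sqNorm_lt hT0 hp.2
    have e2 : |p.2 - c'.2| < 2 * T := abs_snd_lt_of_sqNorm_lt hT0 hp'.2
    rw [abs_lt] at e1 e2
    rw [abs_le]
    constructor <;> linarith
  refine ⟨hfloor, funext fun a => floor_eq_floor_of_cast_eq (D := 8 * T) ?_ hq (congrFun h2 a)⟩
  rw [← hfloor]
  obtain ⟨f1, f2, -⟩ := hc.floor hT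
  obtain ⟨-, f3, -⟩ := hc'.floor hT
  rw [← hfloor] at f3
  have hpos : 0 < θ ⌊c.2⌋ := hθ.pos _ f1.le
  have key : ∀ c : EuclideanSpace ℝ (Fin n) × ℝ, p ∈ endBall φ θ (2 * T) c → 1 ≤ θ c.2 →
      θ c.2 * ‖φ p.1 - c.1‖ ≤ 2 * T := fun c hp h1 => by
    have := (norm_fst_lt_of_sqNorm_lt hT0 hp.2).le
    rwa [endCoord, norm_smul, Real.norm_eq_abs, abs_of_nonneg (zero_le_one.trans h1)] at this
  have k1 := key c hp hc.one_le
  have k2 := key c' hp' hc'.one_le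
  set τ := θ ⌊c.2⌋
  have k3 : τ * ‖φ p.1 - c.1‖ ≤ 4 * T := by
    have := mul_le_mul_of_nonneg_right f2 (norm_nonneg (φ p.1 - c.1))
    linarith
  have k4 : τ * ‖φ p.1 - c'.1‖ ≤ 4 * T := by
    have := mul_le_mul_of_nonneg_right f3 (norm_nonneg (φ p.1 - c'.1))
    linarith
  have k5 : ‖c.1 - c'.1‖ ≤ ‖φ p.1 - c.1‖ + ‖φ p.1 - c'.1‖ := by
    rw [norm_sub_rev (φ p.1) c.1]
    exact norm_sub_le_norm_sub_add_norm_sub _ _ _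
  have k6 : |c.1 a - c'.1 a| ≤ ‖c.1 - c'.1‖ := by
    have := PiLp.norm_apply_le (c.1 - c'.1) a
    simpa using this
  rw [← mul_sub, abs_mul, abs_of_pos hpos]
  calc τ * |c.1 a - c'.1 a| ≤ τ * (‖φ p.1 - c.1‖ + ‖φ p.1 - c'.1‖) := by
        gcongr; exact k6.trans k5
    _ ≤ 8 * T := by rw [mul_add]; linarith

/-- Here `c'` is a network point near `p` and `c` the representative of its cell. Passing to `c`
costs at most `1` in height and `2n` along `N`, and the change of scale doubles `S` along `N`. The
components are at most `S + 1` and `2S + 2n`, whose sum is `T / 4`. -/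
theorem sqNorm_endCoord_le_of_cellIndex_eq (hθ : IsSubconicScaling θ) {S : ℝ} (hS : 0 < S)
    (hT : T = 4 * (3 * S + 2 * n + 1)) {v₀ : EuclideanSpace ℝ (Fin n)} {r₀ : ℝ}
    {c c' : EuclideanSpace ℝ (Fin n) × ℝ} (hc : IsGoodCenter θ K T c.1 c.2)
    (hc' : IsGoodCenter θ K T c'.1 c'.2) (h : cellIndex θ c' = cellIndex θ c)
    (hr : |c'.2 - r₀| ≤ S) (hv : θ r₀ * ‖c'.1 - v₀‖ ≤ S) {p : N × ℝ} (hp1 : φ p.1 = v₀)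
    (hp2 : p.2 = r₀) : sqNorm (endCoord φ c.1 (θ c.2) c.2 p) ≤ (T / 4) ^ 2 := by
  have hn : (0 : ℝ) ≤ n := Nat.cast_nonneg n
  have hT1 : 1 ≤ T := by linarith
  obtain ⟨g1, g2, g3⟩ := hc'.floor hT1
  obtain ⟨e1, e2⟩ := norm_le_of_cellIndex_eq h (hθ.pos _ g1.le).le
  have hfl : ⌊c'.2⌋ = ⌊c.2⌋ := congrArg Prod.fst h
  obtain ⟨-, -, g4⟩ := hc.floor hT1
  rw [← hfl] at g4
  rw [abs_le] at e1 hr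
  have hrc : |r₀ - c.2| ≤ S + 1 := by rw [abs_le]; constructor <;> linarith
  obtain ⟨-, -, g5⟩ := hc.of_abs_lt (r := r₀) (lt_of_le_of_lt hrc (by linarith))
  have hpos : 0 < θ c.2 := lt_of_lt_of_le one_pos hc.one_le
  have k1 : θ c.2 * ‖c'.1 - c.1‖ ≤ 2 * n := by
    have := mul_le_mul_of_nonneg_right g4 (norm_nonneg (c'.1 - c.1))
    linarith
  have k2 : θ c.2 * ‖c'.1 - v₀‖ ≤ 2 * S := by
    have := mul_le_mul_of_nonneg_right g5 (norm_nonneg (c'.1 - v₀))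
    linarith
  have k3 : θ c.2 * ‖v₀ - c.1‖ ≤ 2 * S + 2 * n := by
    have : ‖v₀ - c.1‖ ≤ ‖c'.1 - v₀‖ + ‖c'.1 - c.1‖ := by
      rw [norm_sub_rev c'.1 v₀]
      exact norm_sub_le_norm_sub_add_norm_sub _ _ _
    have := mul_le_mul_of_nonneg_left this hpos.le
    linarith
  simp only [sqNorm, endCoord, hp1, hp2, norm_smul, Real.norm_eq_abs, abs_of_pos hpos]
  have k4 : (θ c.2 * ‖v₀ - c.1‖) ^ 2 ≤ (2 * S + 2 * n) ^ 2 :=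
    pow_le_pow_left₀ (by positivity) k3 2
  have k5 : (r₀ - c.2) ^ 2 ≤ (S + 1) ^ 2 := by
    rw [← sq_abs]; exact pow_le_pow_left₀ (abs_nonneg _) hrc 2
  rw [hT]
  nlinarith [mul_nonneg (by linarith : 0 ≤ 2 * S + 2 * n) (by linarith : 0 ≤ S + 1)]

end Net

/-! ### A finite atlas of the cross-section. -/

section GoodAtlas

variable {n : ℕ} {N : Type*} [TopologicalSpace N] [CompactSpace N]
  [ChartedSpace (EuclideanSpace ℝ (Fin n)) N] [IsManifold (𝓡 n) ∞ N]
  [RiemannianBundle (fun y : N => TangentSpace (𝓡 n) y)]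
  [IsContMDiffRiemannianBundle (𝓡 n) ∞ (EuclideanSpace ℝ (Fin n))
      (fun y : N => TangentSpace (𝓡 n) y)]

theorem Finset.exists_pos_forall_le {α : Type*} (s : Finset α) {ε : α → ℝ}
    (hε : ∀ i, 0 < ε i) : ∃ δ : ℝ, 0 < δ ∧ ∀ i ∈ s, δ ≤ ε i := by
  classical
  induction s using Finset.induction_on with
  | empty => exact ⟨1, one_pos, by simp⟩
  | insert i s _ ih =>
    obtain ⟨δ, hδ, h⟩ := ih
    refine ⟨min δ (ε i), lt_min hδ (hε i), fun j hj => ?_⟩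
    rcases Finset.mem_insert.1 hj with rfl | hj
    · exact min_le_right _ _
    · exact (min_le_left _ _).trans (h j hj)

/-- A compact Riemannian manifold is covered by finitely many coordinate balls whose concentric
balls of three times the radius are still contained in the charts, with the metric uniformly
comparable with the Euclidean one there. -/
theorem exists_finite_good_atlas :
    ∃ (s : Finset N) (ε : N → ℝ) (δ κ : ℝ), 0 < δ ∧ 1 ≤ κ ∧ (∀ i ∈ s, δ ≤ ε i) ∧
      (∀ i, Metric.closedBall (chartAt (EuclideanSpace ℝ (Fin n)) i i) (3 * ε i) ⊆
        (chartAt (EuclideanSpace ℝ (Fin n)) i).target) ∧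
      (∀ i ∈ s, ∀ v ∈ Metric.closedBall (chartAt (EuclideanSpace ℝ (Fin n)) i i) (3 * ε i), ∀ w,
        ‖w‖ ^ 2 ≤ κ * chartForm (chartAt (EuclideanSpace ℝ (Fin n)) i) v w w ∧
        chartForm (chartAt (EuclideanSpace ℝ (Fin n)) i) v w w ≤ κ * ‖w‖ ^ 2) ∧
      ∀ y : N, ∃ i ∈ s, y ∈ (chartAt (EuclideanSpace ℝ (Fin n)) i).source ∧
        dist (chartAt (EuclideanSpace ℝ (Fin n)) i y)
          (chartAt (EuclideanSpace ℝ (Fin n)) i i) < ε i := by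
  have hball : ∀ i : N, ∃ ε : ℝ, 0 < ε ∧
      Metric.closedBall (chartAt (EuclideanSpace ℝ (Fin n)) i i) (3 * ε) ⊆
        (chartAt (EuclideanSpace ℝ (Fin n)) i).target := fun i => by
    obtain ⟨ε, hε, h⟩ := Metric.nhds_basis_closedBall.mem_iff.1
      ((chartAt (EuclideanSpace ℝ (Fin n)) i).open_target.mem_nhds
        (mem_chart_target (EuclideanSpace ℝ (Fin n)) i))
    exact ⟨ε / 3, by positivity, by rwa [mul_div_cancel₀ _ three_ne_zero]⟩
  choose ε hε hball using hball
  have hκ : ∀ i : N, ∃ κ : ℝ, 1 ≤ κ ∧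
      ∀ v ∈ Metric.closedBall (chartAt (EuclideanSpace ℝ (Fin n)) i i) (3 * ε i), ∀ w,
        ‖w‖ ^ 2 ≤ κ * chartForm (chartAt (EuclideanSpace ℝ (Fin n)) i) v w w ∧
        chartForm (chartAt (EuclideanSpace ℝ (Fin n)) i) v w w ≤ κ * ‖w‖ ^ 2 := fun i =>
    exists_chartForm_bounds (IsManifold.chart_mem_maximalAtlas i) (isCompact_closedBall _ _)
      (hball i)
  choose κ hκ1 hκ using hκ
  obtain ⟨s, hs⟩ := CompactSpace.elim_nhds_subcover
    (fun i : N => (chartAt (EuclideanSpace ℝ (Fin n)) i).source ∩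
      chartAt (EuclideanSpace ℝ (Fin n)) i ⁻¹'
        Metric.ball (chartAt (EuclideanSpace ℝ (Fin n)) i i) (ε i)) fun i => by
    refine inter_mem (chart_source_mem_nhds _ i) ?_
    exact ((chartAt (EuclideanSpace ℝ (Fin n)) i).continuousAt (mem_chart_source _ i))
      (Metric.ball_mem_nhds _ (hε i))
  obtain ⟨δ, hδ, hδε⟩ := Finset.exists_pos_forall_le s hε
  have hκs : ∀ i ∈ s, κ i ≤ 1 + ∑ i ∈ s, κ i := fun i hi => by
    have := Finset.single_le_sum (f := κ) (fun i _ => zero_le_one.trans (hκ1 i)) hi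
    linarith
  refine ⟨s, ε, δ, 1 + ∑ i ∈ s, κ i, hδ, ?_, hδε, hball, fun i hi v hv w => ?_, fun y => ?_⟩
  · have := Finset.sum_nonneg fun i (_ : i ∈ s) => zero_le_one.trans (hκ1 i)
    linarith
  · obtain ⟨h1, h2⟩ := hκ i v hv w
    have h3 : 0 ≤ chartForm (chartAt (EuclideanSpace ℝ (Fin n)) i) v w w := real_inner_self_nonneg
    exact ⟨h1.trans (mul_le_mul_of_nonneg_right (hκs i hi) h3),
      h2.trans (mul_le_mul_of_nonneg_right (hκs i hi) (sq_nonneg _))⟩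
  · have hy : y ∈ ⋃ i ∈ s, (chartAt (EuclideanSpace ℝ (Fin n)) i).source ∩
      chartAt (EuclideanSpace ℝ (Fin n)) i ⁻¹'
        Metric.ball (chartAt (EuclideanSpace ℝ (Fin n)) i i) (ε i) := by rw [hs]; trivial
    simp only [mem_iUnion] at hy
    obtain ⟨i, hi, hy⟩ := hy
    exact ⟨i, hi, hy.1, hy.2⟩

end GoodAtlas

theorem warpedMetric_self_nonneg {n : ℕ} {N : Type*} [TopologicalSpace N]
    [ChartedSpace (EuclideanSpace ℝ (Fin n)) N] [IsManifold (𝓡 n) ∞ N]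
    [RiemannianBundle (fun y : N => TangentSpace (𝓡 n) y)] (θ : ℝ → ℝ) (p : N × ℝ)
    (v : TangentSpace (endModel n) p) : 0 ≤ warpedMetric n θ p v v :=
  add_nonneg (mul_self_nonneg _) (mul_nonneg (sq_nonneg _) real_inner_self_nonneg)

end

/-! ### Choice of the constants and assembly of the functions. -/

theorem lemma3p2 {n : ℕ}
    -- the closed cross-section of the end, with its smooth Riemannian metric `h`
    {N : Type*} [TopologicalSpace N] [CompactSpace N] [T2Space N]
    [ChartedSpace (EuclideanSpace ℝ (Fin n)) N] [IsManifold (𝓡 n) ∞ N]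
    [RiemannianBundle (fun y : N => TangentSpace (𝓡 n) y)]
    [IsContMDiffRiemannianBundle (𝓡 n) ∞ (EuclideanSpace ℝ (Fin n))
      (fun y : N => TangentSpace (𝓡 n) y)]
    -- the scaling function of the end
    (θ : ℝ → ℝ) (hθ : IsSubconicScaling θ)
    -- the ambient Riemannian manifold `(M, g)` with its Riemannian distance
    {M : Type*} [EMetricSpace M]
    [ChartedSpace (EuclideanSpace ℝ (Fin (n + 1))) M] [IsManifold (𝓡 (n + 1)) ∞ M]
    [RiemannianBundle (fun x : M => TangentSpace (𝓡 (n + 1)) x)]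
    [IsContMDiffRiemannianBundle (𝓡 (n + 1)) ∞ (EuclideanSpace ℝ (Fin (n + 1)))
      (fun x : M => TangentSpace (𝓡 (n + 1)) x)]
    [IsRiemannianManifold (𝓡 (n + 1)) M]
    -- the identification of `N × (1, ∞)` with an open subset of `M`, the end
    (Φ : PartialDiffeomorph (endModel n) (𝓡 (n + 1)) (N × ℝ) M ∞)
    (hΦ : Φ.source = univ ×ˢ Ioi 1)
    -- on the end, `g` is uniformly comparable with `g₀ = dr² + θ(r)² h`
    (c C : ℝ) (hc : 0 < c)
    (hg : ∀ p ∈ Φ.source, ∀ v : TangentSpace (endModel n) p,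
      c * warpedMetric n θ p v v ≤ ‖mfderiv (endModel n) (𝓡 (n + 1)) Φ p v‖ ^ 2 ∧
      ‖mfderiv (endModel n) (𝓡 (n + 1)) Φ p v‖ ^ 2 ≤ C * warpedMetric n θ p v v)
    -- the damping and the Network Control Condition on `(M, g)`
    (a : M → ℝ) (L η β : ℝ) (P : Set M) (hP : NetworkControl a L η β P) :
    ∃ R : ℝ, 1 ≤ R ∧ ∃ m : ℕ, 1 ≤ m ∧ ∃ ψ : Fin m → N × ℝ → ℝ, ∃ ρ : ℝ, 0 < ρ ∧
      (∀ k, IsCbInfty (warpedMetric n θ) (endBasis n) (univ ×ˢ Ioi R) (ψ k)) ∧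
      (∀ k, ∀ x ∈ (univ : Set N) ×ˢ Ioi R, 0 ≤ ψ k x ∧ ψ k x ≤ 3) ∧
      (∀ k, ∀ x ∈ (univ : Set N) ×ˢ Ioi R, Φ x ∉ controlRegion a (2 * β) →
        gradNorm (warpedMetric n θ) (ψ k) x < 2 * ρ →
        ∃ l, 1 ≤ ψ l x ∧ 2 * ρ ≤ gradNorm (warpedMetric n θ) (ψ l) x ∧
          ψ k x + 1 / 2 ≤ ψ l x) := by
  rcases isEmpty_or_nonempty N with hN | hN
  -- If `N` is empty so is the end, and one zero function serves.
  · refine ⟨1, le_rfl, 1, le_rfl, fun _ _ => 0, 1, one_pos, fun _ => ⟨fun p => ?_, fun _ =>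
      ⟨0, fun p => ?_⟩⟩, fun _ p => ?_, fun _ p => ?_⟩ <;> exact isEmptyElim p.1
  obtain ⟨s, ε, δ, κ, hδ, hκ1, hδε, hball, hκ, hcov⟩ := exists_finite_good_atlas (n := n) (N := N)
  obtain ⟨B, hB0, hB⟩ := exists_abs_fderiv_radialBump_le (V := EuclideanSpace ℝ (Fin n))
  have hκ0 : 0 < κ := by linarith
  have hL := hP.L_pos
  have hn : (0 : ℝ) ≤ n := Nat.cast_nonneg n
  set C' : ℝ := max C 1
  have hC'0 : 0 < C' := lt_of_lt_of_le one_pos (le_max_right _ _)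
  have hC' : ∀ p ∈ Φ.source, ∀ v : TangentSpace (endModel n) p,
      ‖mfderiv (endModel n) (𝓡 (n + 1)) Φ p v‖ ^ 2 ≤ C' * warpedMetric n θ p v v := fun p hp v =>
    (hg p hp v).2.trans
      (mul_le_mul_of_nonneg_right (le_max_left _ _) (warpedMetric_self_nonneg θ p v))
  -- With this radius the extended bump varies by at most `1 < 3` over the distance `L + 1`, so
  -- points at `g`-distance less than `L + 1` lie in the rescaled ball of radius `S`. The `1` is
  -- added because the distance to `P` need not be attained.
  set S : ℝ := B * Real.sqrt (4 * κ / c) * (L + 1) with hSdef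
  have hS0 : 0 < S := by positivity
  set T : ℝ := 4 * (3 * S + 2 * n + 1) with hTdef
  have hT0 : 0 < T := by positivity
  have hT1 : 1 ≤ T := by linarith
  obtain ⟨q, hq⟩ := exists_nat_ge (8 * T + 1)
  have hq0 : NeZero q := ⟨fun h => by rw [h] at hq; norm_num at hq; linarith⟩
  obtain ⟨R₁, hR₁, hgood₁⟩ := exists_isGoodCenter (n := n) hθ S δ hS0 hδ
  obtain ⟨R₂, hR₂, hgood₂⟩ := exists_isGoodCenter (n := n) hθ T δ hT0 hδ
  set φ : N → OpenPartialHomeomorph N (EuclideanSpace ℝ (Fin n)) := fun i =>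
    chartAt (EuclideanSpace ℝ (Fin n)) i
  have hφ : ∀ i, φ i ∈ IsManifold.maximalAtlas (𝓡 n) ∞ N := fun i =>
    IsManifold.chart_mem_maximalAtlas i
  set K : N → Set (EuclideanSpace ℝ (Fin n)) := fun i =>
    Metric.closedBall (φ i i) (3 * ε i)
  -- Points come from the balls of radius `ε i`. The network points near them lie over `K'`, and the
  -- bumps around these lie over `K`; each passage costs at most `δ ≤ ε i`.
  set K' : N → Set (EuclideanSpace ℝ (Fin n)) := fun i =>
    Metric.closedBall (φ i i) (2 * ε i)
  have hKc : ∀ i, IsCompact (K i) := fun i => isCompact_closedBall _ _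
  set Z : N → Set (EuclideanSpace ℝ (Fin n) × ℝ) := fun i =>
    {c | c.1 ∈ K' i ∧ R₂ ≤ c.2 ∧ Φ ((φ i).symm c.1, c.2) ∈ P}
  have hgoodZ : ∀ i ∈ s, ∀ c ∈ Z i, IsGoodCenter θ (K i) T c.1 c.2 := fun i hi c hc => by
    refine hgood₂ _ _ _ hc.2.1 (Metric.closedBall_subset_closedBall' ?_)
    have := hc.1
    rw [Metric.mem_closedBall] at this
    linarith [hδε i hi]
  -- One network point is kept in each occupied cell.
  choose Y hYZ hYbij using fun i => Set.exists_subset_bijOn (Z i) (cellIndex θ)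
  set W : N × (ZMod q × (Fin n → ZMod q)) → Set (EuclideanSpace ℝ (Fin n) × ℝ) := fun k =>
    {c ∈ Y k.1 | cellClass q (cellIndex θ c) = k.2}
  have hWgood : ∀ k : s × (ZMod q × (Fin n → ZMod q)), ∀ c ∈ W (k.1, k.2),
      IsGoodCenter θ (K k.1) T c.1 c.2 := fun k c hc => hgoodZ _ k.1.2 c (hYZ _ hc.1)
  have hdisj : ∀ k : s × (ZMod q × (Fin n → ZMod q)), ∀ c ∈ W (k.1, k.2), ∀ c' ∈ W (k.1, k.2),
      ∀ p ∈ endBall (φ k.1) θ (2 * T) c, p ∈ endBall (φ k.1) θ (2 * T) c' → c = c' :=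
    fun k c hc c' hc' p hp hp' => (hYbij k.1).injOn hc.1 hc'.1
      (cellIndex_eq_of_mem_endBall hθ hT1 (hWgood k c hc) (hWgood k c' hc') hp hp' hq
        (hc.2.trans hc'.2.symm))
  set f : s × (ZMod q × (Fin n → ZMod q)) → N × ℝ → ℝ := fun k =>
    clusterFun (φ k.1) θ T (W (k.1, k.2))
  have hη := hP.η_pos
  -- Chosen so that the rescaled ball of radius `ε₀` is contained in the `g`-ball of radius `η`.
  set ε₀ : ℝ := η / (2 * Real.sqrt (C' * κ)) with hε₀def
  have hsqrt : 0 < Real.sqrt (C' * κ) := Real.sqrt_pos.2 (by positivity)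
  have hε₀ : 0 < ε₀ := by positivity
  have hε₀η : C' * (4 * κ * ε₀ ^ 2) = η ^ 2 := by
    rw [hε₀def, div_pow, mul_pow, Real.sq_sqrt (by positivity)]
    field_simp
    norm_num
  -- points close to a center are controlled
  have hcontrol : ∀ k : s × (ZMod q × (Fin n → ZMod q)), ∀ c ∈ W (k.1, k.2),
      ∀ p ∈ endBall (φ k.1) θ (2 * T) c,
      sqNorm (endCoord (φ k.1) c.1 (θ c.2) c.2 p) < ε₀ ^ 2 →
      Φ p ∈ controlRegion a (2 * β) := fun k c hc p hp hpε => by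
    have h := hWgood k c hc
    have h1 := h.edist_le (hφ k.1) (hball k.1) hκ1 (hκ k.1 k.1.2) hΦ hC'0.le hC' hp.2
    rw [endParam_endCoord h.ne_zero hp.1] at h1
    refine hP.ball_subset _ (hYZ _ hc.1).2.2 _ ?_
    have h2 : endParam (φ k.1) c.1 (θ c.2) c.2 0 = ((φ k.1).symm c.1, c.2) := by simp [endParam]
    rw [h2] at h1
    rw [edist_comm]
    refine h1.trans_lt ((ENNReal.ofReal_lt_ofReal_iff hη).2 ?_)
    rw [Real.sqrt_lt' hη, ← hε₀η]
    gcongr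
  set ρ : ℝ := ε₀ / (T ^ 2 * Real.sqrt κ) / 2 with hρdef
  have hρ : 0 < ρ := by
    have : 0 < Real.sqrt κ := Real.sqrt_pos.2 hκ0
    positivity
  -- the gradient is large where the function is large and the damping is not effective
  have hgrad : ∀ k : s × (ZMod q × (Fin n → ZMod q)), ∀ p : N × ℝ,
      Φ p ∉ controlRegion a (2 * β) → 1 ≤ f k p →
      2 * ρ ≤ gradNorm (warpedMetric n θ) (f k) p := fun k p hpΩ hfp => by
    obtain ⟨c, hc, hpc⟩ := exists_mem_endBall_of_clusterFun_pos (zero_lt_one.trans_le hfp)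
    have hpc2 : p ∈ endBall (φ k.1) θ (2 * T) c := endBall_mono hT0.le (by linarith) _ hpc
    have h := hWgood k c hc
    have hev := clusterFun_eventuallyEq hT0 (hdisj k) hc hpc2
    have hval := hev.eq_of_nhds
    have h1 : ε₀ ^ 2 ≤ sqNorm (endCoord (φ k.1) c.1 (θ c.2) c.2 p) := by
      by_contra! hlt
      exact hpΩ (hcontrol k c hc p hpc2 hlt)
    have hpp : endParam (φ k.1) c.1 (θ c.2) c.2 (endCoord (φ k.1) c.1 (θ c.2) c.2 p) = p :=
      endParam_endCoord h.ne_zero hpc.1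
    have h2 := h.le_gradNorm hT0 (hφ k.1) (hball k.1) hκ1 (hκ k.1 k.1.2) hε₀
      (hfp.trans_eq hval) h1 (f := f k) (by rw [hpp]; exact hev)
    rw [hpp] at h2
    rwa [hρdef, mul_div_cancel₀ _ two_ne_zero]
  -- every point lies well inside one of the balls
  have hcover : ∀ p : N × ℝ, R₁ + R₂ + S < p.2 → ∃ k, 2 ≤ f k p := fun p hp => by
    obtain ⟨i, hi, hpi, hpε⟩ := hcov p.1
    set v := φ i p.1
    have hεi : 0 < ε i := dist_nonneg.trans_lt hpε
    -- The point `p` itself is now the center, at scale `S`, in order to locate a network point near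
    -- it.
    have h₁ : IsGoodCenter θ (K' i) S v p.2 := by
      refine hgood₁ _ _ _ (by linarith) (Metric.closedBall_subset_closedBall' ?_)
      linarith [hδε i hi]
    have hK'K : K' i ⊆ K i := Metric.closedBall_subset_closedBall (by linarith)
    have hp0 : endParam (φ i) v (θ p.2) p.2 0 = p := by
      have : (φ i).symm v = p.1 := (φ i).left_inv hpi
      simp [endParam, this]
    obtain ⟨x, hxP, hx⟩ : ∃ x ∈ P, edist (Φ p) x < ENNReal.ofReal (L + 1) := by
      refine Metric.infEDist_lt_iff.1 ((hP.dist_le _).trans_lt ?_)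
      exact (ENNReal.ofReal_lt_ofReal_iff (by linarith)).2 (by linarith)
    obtain ⟨z, hz, rfl⟩ := h₁.exists_of_edist_lt hS0 (hφ i) (hK'K.trans (hball i)) hκ1
      (fun v hv w => hκ i hi v (hK'K hv) w) hΦ hc (fun p hp v => (hg p hp v).1) hB0 hB
      (D := L + 1) (by linarith) (by
        have : B / S * Real.sqrt (4 * κ / c) * (L + 1) = S / S := by rw [hSdef]; ring
        rw [this, div_self hS0.ne']
        norm_num) (q := x) (by rw [hp0]; exact hx)
    have hz2 : sqNorm z < (2 * S) ^ 2 := by nlinarith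
    set c' : EuclideanSpace ℝ (Fin n) × ℝ := ((θ p.2)⁻¹ • z.1 + v, z.2 + p.2) with hc'def
    have hzS := abs_snd_lt_of_sqNorm_lt hS0.le hz
    have hc'Z : c' ∈ Z i := ⟨h₁.mem z hz2, by
      have := (abs_lt.1 hzS).1
      simp only [hc'def]
      linarith, hxP⟩
    obtain ⟨c₁, hc₁, hcell⟩ := (hYbij i).surjOn ⟨c', hc'Z, rfl⟩
    refine ⟨(⟨i, hi⟩, cellClass q (cellIndex θ c₁)), ?_⟩
    have hcW : c₁ ∈ W (i, cellClass q (cellIndex θ c₁)) := ⟨hc₁, rfl⟩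
    have hsq : sqNorm (endCoord (φ i) c₁.1 (θ c₁.2) c₁.2 p) ≤ (T / 4) ^ 2 := by
      refine sqNorm_endCoord_le_of_cellIndex_eq hθ hS0 hTdef (hgoodZ i hi _ (hYZ i hc₁))
        (hgoodZ i hi _ hc'Z) hcell.symm (r₀ := p.2) ?_ (v₀ := v) ?_ rfl rfl
      · simpa [hc'def] using hzS.le
      · have hpos : 0 < θ p.2 := lt_of_lt_of_le one_pos h₁.one_le
        simp only [hc'def, add_sub_cancel_right, norm_smul, norm_inv, Real.norm_eq_abs,
          abs_of_pos hpos]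
        rw [mul_inv_cancel_left₀ hpos.ne']
        exact (norm_fst_lt_of_sqNorm_lt hS0.le hz).le
    have hmem : p ∈ endBall (φ i) θ (2 * T) c₁ := ⟨hpi, by nlinarith⟩
    have hev := clusterFun_eventuallyEq hT0
      (hdisj (⟨i, hi⟩, cellClass q (cellIndex θ c₁))) hcW hmem
    exact (two_le_radialBump hT0 hsq).trans_eq hev.eq_of_nhds.symm
  have hcard : 1 ≤ Fintype.card (s × (ZMod q × (Fin n → ZMod q))) := by
    obtain ⟨i, hi, -⟩ := hcov hN.some
    have : Nonempty (s × (ZMod q × (Fin n → ZMod q))) := ⟨(⟨i, hi⟩, 0)⟩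
    exact Fintype.card_pos
  let g := (Fintype.equivFin (s × (ZMod q × (Fin n → ZMod q)))).symm
  -- Above this height `p` is a good center at scale `S`, and a network point at most `S` lower is
  -- still above `R₂`, hence a good center at scale `T`.
  have hR : 1 ≤ R₁ + R₂ + S := by linarith
  refine ⟨R₁ + R₂ + S, hR, _, hcard, fun k => f (g k), ρ, hρ, fun k => ?_, fun k x _ =>
    ⟨clusterFun_nonneg x, clusterFun_le hT0 x⟩, fun k x hx hxΩ hlt => ?_⟩
  · exact isCbInfty_clusterFun hθ hT0 (hφ _) (hKc _) (hball _) (hWgood (g k)) (hdisj (g k)) hR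
  · obtain ⟨l, hl⟩ := hcover x hx.2
    have h1 : f (g k) x < 1 := by
      by_contra! h
      exact (hgrad _ x hxΩ h).not_gt hlt
    refine ⟨g.symm l, ?_⟩
    beta_reduce
    rw [Equiv.apply_symm_apply]
    exact ⟨by linarith, hgrad l x hxΩ (by linarith), by linarith⟩
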